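/- For $n\ge 1$, call $\pi\in S_n$ cyclic if it consists of a single $n$-cycle, and let $C(\pi)=(1,c_2,\dots,c_n)$, with $c_2=\pi(1)$ and $c_{i+1}=\pi(c_i)$, be its cycle form beginning with $1$, regarded as the word $1c_2\cdots c_n$. A word avoids a pattern $\sigma$ if it has no subsequence in the same relative order as $\sigma$. Let $\delta_k=k(k-1)\cdots 21$. For $\tau\in\{213,231\}$ let $a_{n,k}(\tau)$ be the number of cyclic permutations $\pi\in S_n$ whose one-line notation $\pi(1)\pi(2)\cdots\pi(n)$ avoids $\delta_k$ and whose cycle form $C(\pi)$ avoids $\tau$ (with $a_{0,k}(\tau)=0$), and let $f_k(z;\tau)=\sum_{n\ge 0}a_{n,k}(\tau)z^n$. Then, as formal power series, for every $k\ge 5$, \[ f_k(z;231)=\frac{f_{k-1}(z;213)\left(f_{k-2}(z;213)^2-f_{k-2}(z;213)+1\right)}{1-z}. \] Moreover, \[ f_4(z;231)=\frac{z(z^3+z^2-2z+1)}{(1-z)(1-2z)},\qquad f_3(z;231)=\frac{z(1-z+z^2)}{(1-z)^2},\qquad f_2(z;231)=z,\qquad f_1(z;231)=0. \] -/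

import Mathlib

open Equiv
open scoped PowerSeries

namespace CyclicPattern

/-- The word `w` contains the pattern `σ`: some subsequence of `w` is in the same relative order
as `σ`. -/
def Contains {α β : Type*} [LinearOrder α] [LinearOrder β] {n k : ℕ}
    (w : Fin n → α) (σ : Fin k → β) : Prop :=
  ∃ e : Fin k ↪o Fin n, ∀ i j : Fin k, w (e i) < w (e j) ↔ σ i < σ j

/-- The word `w` avoids the pattern `σ`. -/
def Avoids {α β : Type*} [LinearOrder α] [LinearOrder β] {n k : ℕ}
    (w : Fin n → α) (σ : Fin k → β) : Prop :=
  ¬ Contains w σ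

/-- The decreasing pattern `k (k-1) ⋯ 2 1`. -/
def decPattern (k : ℕ) : Fin k → ℕ := fun i => k - (i : ℕ)

/-- The pattern `213`. -/
def pattern213 : Fin 3 → ℕ := ![2, 1, 3]

/-- The pattern `231`. -/
def pattern231 : Fin 3 → ℕ := ![2, 3, 1]

/-- `π` is composed of a single `n`-cycle, with `n ≥ 1` (for `n = 1` this is the identity).
The elements `1, …, n` are represented by `0, …, n - 1` in `Fin n`. -/
def IsCyclicPerm {n : ℕ} (π : Perm (Fin n)) : Prop :=
  0 < n ∧ π.IsCycleOn Set.univ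

/-- The cycle form `C(π) = (c₁, c₂, …, cₙ)` of a cyclic permutation, starting with the smallest
element and satisfying `c_{i+1} = π (c_i)`, as a word of length `n`. -/
def cycleForm {n : ℕ} (π : Perm (Fin n)) : Fin n → Fin n :=
  fun i => (π ^ (i : ℕ)) ⟨0, i.pos⟩

/-- The cyclic permutations of size `n` whose one-line notation `π(1) π(2) ⋯ π(n)` avoids `σ` and
whose cycle form avoids `τ`. -/
def cyclicAvoiders (n : ℕ) {k m : ℕ} (σ : Fin k → ℕ) (τ : Fin m → ℕ) : Set (Perm (Fin n)) :=
  {π | IsCyclicPerm π ∧ Avoids (fun i => π i) σ ∧ Avoids (cycleForm π) τ}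

/-- The number `a_{n,k}(τ)` of cyclic permutations of size `n` avoiding `k (k-1) ⋯ 1` in one-line
notation and `τ` in cycle form. -/
noncomputable def avoiderCount (n k : ℕ) {m : ℕ} (τ : Fin m → ℕ) : ℕ :=
  (cyclicAvoiders n (decPattern k) τ).ncard

/-- The generating function `f_k(z; τ) = ∑_{n ≥ 0} a_{n,k}(τ) z^n`, as a formal power series. -/
noncomputable def genFun (k : ℕ) {m : ℕ} (τ : Fin m → ℕ) : ℚ⟦X⟧ :=
  PowerSeries.mk fun n => (avoiderCount n k τ : ℚ)

end CyclicPattern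

/-! The graph of π consists of the consecutive pairs of its cycle form closed up by returning to the
least letter 0. So π avoids δ_k exactly when the path through this closed word has no decreasing
chain of k points, and the task is to compute `lds` recursively along a decomposition of the word.

The leading 0 takes part in no 231 or 213, so only the rest T matters. If T avoids 231, then after
its first letter m the smaller letters all precede the larger ones: T is a succession of blocks of
increasing value (`blockWord`). Inside a block, m is followed by an arbitrary 231-avoider, which
splits at its maximum m' as A m' B with A below B (`peakWord`). If T avoids 213, complementing
values gives a 231-avoider entered from above and left to above, and the half-turn of the plane
preserves chain lengths. So both families are coded by binary trees.

When A is nonempty, the points inside A lie southwest of the path through m' B, so no chain meets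
both. The edge entering m' extends every chain of m' B at the northwest end, and an edge from above
into A extends it at the southeast end. Such facts give the max-recursions `stats` and `blockStat`,
and each max-recursion becomes an equation between generating functions.

Write F, C, D for `fromAboveGF`, `cycleGF`, `cycleToAboveGF`. Then C_k = F_k for k ≥ 3, F_{k+1}(1 -
F_k) = X, and D_k - X = F_{k-1}^2 for k ≥ 4; eliminating gives the formula for k ≥ 5. Since C_2 = X
differs from F_2 = X/(1 - X), k = 4 is exceptional. -/

namespace CyclicPattern

/-! ### Longest decreasing chains in finite planar point sets -/

/-- The point `p` lies strictly to the left of and above the point `q`. -/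
def NorthWest (p q : ℕ × ℕ) : Prop := p.1 < q.1 ∧ q.2 < p.2

open Classical in
/-- The largest size of a decreasing chain in a finite set of points of the plane. -/
noncomputable def lds (S : Finset (ℕ × ℕ)) : ℕ :=
  (S.powerset.filter fun T : Finset (ℕ × ℕ) => IsChain NorthWest (T : Set (ℕ × ℕ))).sup Finset.card

theorem lds_le_iff {S : Finset (ℕ × ℕ)} {n : ℕ} :
    lds S ≤ n ↔ ∀ T ⊆ S, IsChain NorthWest (T : Set (ℕ × ℕ)) → T.card ≤ n := by
  simp [lds, Finset.sup_le_iff]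

theorem card_le_lds {S T : Finset (ℕ × ℕ)} (h : T ⊆ S)
    (hT : IsChain NorthWest (T : Set (ℕ × ℕ))) : T.card ≤ lds S :=
  lds_le_iff.1 le_rfl T h hT

theorem exists_card_eq_lds (S : Finset (ℕ × ℕ)) :
    ∃ T ⊆ S, IsChain NorthWest (T : Set (ℕ × ℕ)) ∧ T.card = lds S := by
  classical
  obtain ⟨T, hT, h⟩ := Finset.exists_mem_eq_sup
    (S.powerset.filter fun T : Finset (ℕ × ℕ) => IsChain NorthWest (T : Set (ℕ × ℕ)))
    ⟨∅, by simp⟩ Finset.card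
  simp only [Finset.mem_filter, Finset.mem_powerset] at hT
  refine ⟨T, hT.1, hT.2, ?_⟩
  rw [lds, ← h]

theorem lds_lt_iff {S : Finset (ℕ × ℕ)} {k : ℕ} :
    lds S < k ↔ ¬ ∃ T ⊆ S, IsChain NorthWest (T : Set (ℕ × ℕ)) ∧ T.card = k := by
  constructor
  · rintro h ⟨T, hS, hT, rfl⟩
    exact absurd (card_le_lds hS hT) (by omega)
  · intro h
    by_contra! hk
    obtain ⟨T, hS, hT, hc⟩ := exists_card_eq_lds S
    obtain ⟨U, hU, hUc⟩ := Finset.exists_subset_card_eq (hc ▸ hk : k ≤ T.card)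
    exact h ⟨U, hU.trans hS, hT.mono (by exact_mod_cast hU), hUc⟩

theorem lds_mono {S T : Finset (ℕ × ℕ)} (h : S ⊆ T) : lds S ≤ lds T :=
  lds_le_iff.2 fun _ hU hc => card_le_lds (hU.trans h) hc

@[simp] theorem lds_empty : lds ∅ = 0 := by
  apply Nat.le_zero.1
  rw [lds_le_iff]
  intro T hT _
  simp [Finset.subset_empty.1 hT]

@[simp] theorem lds_singleton (p : ℕ × ℕ) : lds {p} = 1 := by
  apply le_antisymm
  · rw [lds_le_iff]
    intro T hT _
    simpa using Finset.card_le_card hT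
  · simpa using card_le_lds (Finset.Subset.refl {p}) (by simp [IsChain])

theorem lds_union_le (S T : Finset (ℕ × ℕ)) : lds (S ∪ T) ≤ lds S + lds T := by
  rw [lds_le_iff]
  intro U hU hc
  have h1 : (U ∩ S).card ≤ lds S :=
    card_le_lds Finset.inter_subset_right (hc.mono (by simp))
  have h2 : (U ∩ T).card ≤ lds T :=
    card_le_lds Finset.inter_subset_right (hc.mono (by simp))
  have h3 : U = (U ∩ S) ∪ (U ∩ T) := by
    rw [← Finset.inter_union_distrib_left]
    exact (Finset.inter_eq_left.2 hU).symm
  have h4 := Finset.card_union_le (U ∩ S) (U ∩ T)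
  rw [← h3] at h4
  omega

theorem lds_union_of_series {S T : Finset (ℕ × ℕ)} (h : ∀ s ∈ S, ∀ t ∈ T, NorthWest s t) :
    lds (S ∪ T) = lds S + lds T := by
  apply le_antisymm (lds_union_le S T)
  obtain ⟨U, hU, hUc, hU'⟩ := exists_card_eq_lds S
  obtain ⟨V, hV, hVc, hV'⟩ := exists_card_eq_lds T
  have hd : Disjoint U V := by
    rw [Finset.disjoint_left]
    intro a ha hb
    exact absurd (h a (hU ha) a (hV hb)).1 (lt_irrefl _)
  rw [← hU', ← hV', ← Finset.card_union_of_disjoint hd]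
  apply card_le_lds (Finset.union_subset_union hU hV)
  rw [Finset.coe_union]
  rintro x (hx | hx) y (hy | hy) hne
  · exact hUc hx hy hne
  · exact Or.inl (h x (hU hx) y (hV hy))
  · exact Or.inr (h y (hU hy) x (hV hx))
  · exact hVc hx hy hne

/-- A chain containing a point of T outside S has no point of S outside T, so it lies in T. Shared
points are harmless, which allows overlapping covers of a path. -/
theorem lds_union_of_incomparable {S T : Finset (ℕ × ℕ)}
    (h : ∀ s ∈ S, s ∉ T → ∀ t ∈ T, t ∉ S → ¬ NorthWest s t ∧ ¬ NorthWest t s) :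
    lds (S ∪ T) = max (lds S) (lds T) := by
  apply le_antisymm
  · rw [lds_le_iff]
    intro U hU hc
    by_cases hS : U ⊆ S
    · exact le_max_of_le_left (card_le_lds hS hc)
    · obtain ⟨t, htU, htS⟩ := Finset.not_subset.1 hS
      have htT : t ∈ T := (Finset.mem_union.1 (hU htU)).resolve_left htS
      refine le_max_of_le_right (card_le_lds (fun s hs => ?_) hc)
      by_contra hsT
      have hsS : s ∈ S := (Finset.mem_union.1 (hU hs)).resolve_right hsT
      have hne : s ≠ t := fun e => hsT (e ▸ htT)
      have := h s hsS hsT t htT htS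
      exact (hc hs htU hne).elim this.1 this.2
  · exact max_le (lds_mono Finset.subset_union_left) (lds_mono Finset.subset_union_right)

theorem lds_insert_le (p : ℕ × ℕ) (S : Finset (ℕ × ℕ)) : lds (insert p S) ≤ 1 + lds S := by
  rw [Finset.insert_eq]
  simpa using lds_union_le {p} S

theorem lds_insert_first {p : ℕ × ℕ} {S : Finset (ℕ × ℕ)} (h : ∀ s ∈ S, NorthWest p s) :
    lds (insert p S) = 1 + lds S := by
  rw [Finset.insert_eq, lds_union_of_series (by simpa using h), lds_singleton]

theorem lds_insert_last {p : ℕ × ℕ} {S : Finset (ℕ × ℕ)} (h : ∀ s ∈ S, NorthWest s p) :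
    lds (insert p S) = 1 + lds S := by
  rw [Finset.insert_eq, Finset.union_comm, lds_union_of_series (by simpa using h), lds_singleton,
    add_comm]

/-- Inserting a second point that is incomparable to a point extending every chain does not
create longer chains. -/
theorem lds_insert_insert {p q : ℕ × ℕ} {S : Finset (ℕ × ℕ)}
    (h : lds (insert p S) = 1 + lds S) (hpq : ¬ NorthWest p q ∧ ¬ NorthWest q p) :
    lds (insert p (insert q S)) = 1 + lds S := by
  have e : insert p (insert q S) = insert p S ∪ insert q S := by
    ext; simp; tauto
  rw [e, lds_union_of_incomparable, h, max_eq_left (lds_insert_le q S)]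
  intro s hs hs' t ht ht'
  have h1 : s = p := by simp at hs hs'; tauto
  have h2 : t = q := by simp at ht ht'; tauto
  subst h1 h2
  exact hpq

theorem lds_image_complement {S : Finset (ℕ × ℕ)} {c : ℕ} (h : ∀ p ∈ S, p.1 ≤ c ∧ p.2 ≤ c) :
    lds (S.image fun p => (c - p.1, c - p.2)) = lds S := by
  have key : ∀ S : Finset (ℕ × ℕ), (∀ p ∈ S, p.1 ≤ c ∧ p.2 ≤ c) →
      lds S ≤ lds (S.image fun p => (c - p.1, c - p.2)) := by
    intro S h
    rw [lds_le_iff]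
    intro T hT hc
    rw [← Finset.card_image_of_injOn (s := T) (f := fun p : ℕ × ℕ => (c - p.1, c - p.2))]
    · apply card_le_lds (Finset.image_subset_image hT)
      rw [Finset.coe_image]
      rintro _ ⟨p, hp, rfl⟩ _ ⟨q, hq, rfl⟩ hne
      have hpq : p ≠ q := fun e => hne (by rw [e])
      have := h p (hT hp)
      have := h q (hT hq)
      rcases hc hp hq hpq with h' | h'
      · right; simp only [NorthWest] at h' ⊢; omega
      · left; simp only [NorthWest] at h' ⊢; omega
    · intro p hp q hq hpq
      have := h p (hT hp)
      have := h q (hT hq)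
      simp only [Prod.mk.injEq] at hpq
      exact Prod.ext (by omega) (by omega)
  refine le_antisymm ?_ (key S h)
  -- The half-turn is an involution, so `key` applied to the image gives the reverse inequality.
  have h2 : (S.image fun p => (c - p.1, c - p.2)).image (fun p => (c - p.1, c - p.2)) = S := by
    rw [Finset.image_image]
    refine (Finset.image_congr (g := id) fun p hp => ?_).trans Finset.image_id
    have := h p hp
    exact Prod.ext (Nat.sub_sub_self this.1) (Nat.sub_sub_self this.2)
  have h3 := key (S.image fun p => (c - p.1, c - p.2)) (by
    intro q hq
    obtain ⟨p, _, rfl⟩ := Finset.mem_image.1 hq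
    exact ⟨Nat.sub_le _ _, Nat.sub_le _ _⟩)
  rwa [h2] at h3

/-! ### The points of a path -/

/-- The set of pairs of consecutive entries of a list. -/
def path : List ℕ → Finset (ℕ × ℕ)
  | [] => ∅
  | [_] => ∅
  | a :: b :: l => insert (a, b) (path (b :: l))

theorem path_cons_append {a : ℕ} {A : List ℕ} (hA : A ≠ []) :
    ∃ x ∈ A, ∀ l, path (a :: (A ++ l)) = insert (a, x) (path (A ++ l)) := by
  cases A with
  | nil => exact absurd rfl hA
  | cons x A => exact ⟨x, by simp, fun l => rfl⟩

theorem path_append_cons (A : List ℕ) (x : ℕ) (B : List ℕ) :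
    path (A ++ x :: B) = path (A ++ [x]) ∪ path (x :: B) := by
  induction A with
  | nil => simp [path]
  | cons a A ih =>
    cases A with
    | nil => simp [path]
    | cons b A =>
      simp only [List.cons_append, path] at ih ⊢
      rw [ih, Finset.insert_union]

theorem path_append_singleton {A : List ℕ} (hA : A ≠ []) (x : ℕ) :
    path (A ++ [x]) = insert (A.getLast hA, x) (path A) := by
  induction A with
  | nil => exact absurd rfl hA
  | cons a A ih =>
    cases A with
    | nil => simp [path]
    | cons b A =>
      simp only [List.cons_append, path] at ih ⊢
      rw [ih (by simp), Finset.insert_comm]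
      simp

theorem mem_path_cons {a : ℕ} {l : List ℕ} {p : ℕ × ℕ} (h : p ∈ path (a :: l)) :
    p.1 ∈ a :: l ∧ p.2 ∈ l := by
  induction l generalizing a with
  | nil => simp [path] at h
  | cons b l ih =>
    simp only [path, Finset.mem_insert] at h
    rcases h with rfl | h
    · simp
    · have := ih h
      simp only [List.mem_cons] at this ⊢
      tauto

theorem mem_path {l : List ℕ} {p : ℕ × ℕ} (h : p ∈ path l) : p.1 ∈ l ∧ p.2 ∈ l := by
  cases l with
  | nil => simp [path] at h
  | cons a l =>
    have := mem_path_cons h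
    simp only [List.mem_cons] at this ⊢
    tauto

theorem mem_path_append_singleton {l : List ℕ} {x : ℕ} {p : ℕ × ℕ} (h : p ∈ path (l ++ [x])) :
    p.1 ∈ l := by
  by_cases hl : l = []
  · subst hl
    simp [path] at h
  · rw [path_append_singleton hl] at h
    rcases Finset.mem_insert.1 h with rfl | h
    · exact List.getLast_mem hl
    · exact (mem_path h).1

theorem path_map (f : ℕ → ℕ) (l : List ℕ) :
    path (l.map f) = (path l).image fun p => (f p.1, f p.2) := by
  induction l with
  | nil => simp [path]
  | cons a l ih =>
    cases l with
    | nil => simp [path]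
    | cons b l =>
      simp only [List.map_cons, path] at ih ⊢
      rw [ih, Finset.image_insert]

theorem mem_path_iff {l : List ℕ} {p : ℕ × ℕ} :
    p ∈ path l ↔ ∃ i, l[i]? = some p.1 ∧ l[i + 1]? = some p.2 := by
  induction l with
  | nil => simp [path]
  | cons a l ih =>
    cases l with
    | nil => simp [path]
    | cons b l =>
      simp only [path, Finset.mem_insert, ih]
      constructor
      · rintro (rfl | ⟨i, h1, h2⟩)
        · exact ⟨0, by simp⟩
        · exact ⟨i + 1, by simpa using ⟨h1, h2⟩⟩
      · rintro ⟨_ | i, h1, h2⟩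
        · left
          simp only [List.getElem?_cons_zero, zero_add, List.getElem?_cons_succ,
            Option.some.injEq] at h1 h2
          ext <;> simp [h1, h2]
        · right
          exact ⟨i, by simpa using h1, by simpa using h2⟩

/-! ### Chains in the path of a word decomposed at its maximum -/

section Decomposition

variable {A B : List ℕ} {m m' e : ℕ}

/-- The edge (m, m') lies northeast of all other points, hence is comparable to none. -/
theorem lds_path_peak_of_nil (hB : ∀ b ∈ B, b < m') (hm : m' < m) :
    lds (path (m :: ([] ++ m' :: B))) = max 1 (lds (path (m' :: B))) := by
  simp only [List.nil_append, path]
  rw [Finset.insert_eq, lds_union_of_incomparable, lds_singleton]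
  intro s hs _ t ht _
  rw [Finset.mem_singleton] at hs
  subst hs
  have h := mem_path_cons ht
  have := hB _ h.2
  have : t.1 ≤ m' := by
    rcases List.mem_cons.1 h.1 with h | h
    · exact h.le
    · exact (hB _ h).le
  simp only [NorthWest]
  omega

/-- With x and y the first and last letters of A, the edge (y, m') is northwest and (m, x) southeast
of the whole path through m' B, whence the 2. The points inside A are southwest of that path. -/
theorem lds_path_peak (hA : A ≠ []) (hAB : ∀ a ∈ A, ∀ b ∈ B, a < b) (hAm : ∀ a ∈ A, a < m')
    (hB : ∀ b ∈ B, b < m') (hm : m' < m) :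
    lds (path (m :: (A ++ m' :: B))) =
      max (lds (path (m :: (A ++ [m'])))) (2 + lds (path (m' :: B))) := by
  obtain ⟨x, hx, hp⟩ := path_cons_append (a := m) hA
  have hy := List.getLast_mem hA
  set y := A.getLast hA
  have hV : ∀ p ∈ path (m' :: B), (∀ a ∈ A, a < p.1) ∧ p.1 < m ∧ (∀ a ∈ A, a < p.2) ∧ p.2 < m' := by
    intro p h
    have h := mem_path_cons h
    refine ⟨fun a ha => ?_, ?_, fun a ha => hAB a ha _ h.2, hB _ h.2⟩ <;>
      rcases List.mem_cons.1 h.1 with h' | h'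
    · have := hAm a ha; omega
    · exact hAB a ha _ h'
    · omega
    · have := hB _ h'; omega
  -- The two pieces share the edges (m, x) and (y, m'), which may extend chains of either.
  have e1 : path (m :: (A ++ m' :: B)) =
      path (m :: (A ++ [m'])) ∪ insert (m, x) (insert (y, m') (path (m' :: B))) := by
    rw [hp, hp, path_append_cons, path_append_singleton hA]
    ext p; simp only [Finset.mem_insert, Finset.mem_union]; tauto
  rw [e1, lds_union_of_incomparable, lds_insert_last, lds_insert_first, ← add_assoc]
  · intro s hs
    have h := hV s hs
    have := h.1 y hy
    simp only [NorthWest]; omega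
  · intro s hs
    have := hAm x hx
    have := hAm y hy
    rcases Finset.mem_insert.1 hs with rfl | hs
    · simp only [NorthWest]; omega
    · have h := hV s hs
      have := h.2.2.1 x hx
      simp only [NorthWest]; omega
  · intro s hs hs' t ht ht'
    rw [hp, path_append_singleton hA] at hs ht'
    simp only [Finset.mem_insert, not_or] at hs hs' ht ht'
    have hsA : s ∈ path A := by tauto
    have htV : t ∈ path (m' :: B) := by tauto
    have h1 := mem_path hsA
    have h2 := hV t htV
    have := h2.1 _ h1.1
    have := h2.2.2.1 _ h1.2
    simp only [NorthWest]; omega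

/-- The closing edge (z, e) is northwest of (m, m'), giving a chain of two; (m, m') is comparable to
nothing else. -/
theorem lds_closed_path_peak_of_nil (hB : ∀ b ∈ B, b < m') (hm : m' < m) (he : m' < e) :
    lds (path (m :: ([] ++ m' :: B ++ [e]))) = max 2 (lds (path (m' :: (B ++ [e])))) := by
  have hz := List.getLast_mem (List.cons_ne_nil m' B)
  have hq := path_append_singleton (List.cons_ne_nil m' B) e
  set z := (m' :: B).getLast (List.cons_ne_nil m' B)
  have hz' : z ≤ m' := by
    rcases List.mem_cons.1 hz with h | h
    · omega
    · exact (hB _ h).le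
  have e1 : path (m :: ([] ++ m' :: B ++ [e])) =
      insert (m, m') {(z, e)} ∪ path (m' :: (B ++ [e])) := by
    simp only [List.nil_append, List.cons_append, path] at hq ⊢
    rw [hq]
    ext p; simp only [Finset.mem_insert, Finset.mem_union, Finset.mem_singleton]; tauto
  rw [e1, lds_union_of_incomparable, lds_insert_last, lds_singleton]
  · simp only [Finset.mem_singleton, forall_eq, NorthWest]; omega
  · intro s hs hs' t ht ht'
    rw [← List.cons_append, hq] at ht hs'
    simp only [Finset.mem_insert, Finset.mem_singleton, not_or] at hs hs' ht ht'
    have hs1 : s = (m, m') := by tauto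
    have htV : t ∈ path (m' :: B) := by tauto
    have h := mem_path_cons htV
    have := hB _ h.2
    have : t.1 ≤ m' := by
      rcases List.mem_cons.1 h.1 with h | h
      · exact h.le
      · exact (hB _ h).le
    subst hs1
    simp only [NorthWest]; omega

/-- The closing edge (z, e) lies northeast of (y, m'), so no chain contains both, and returning
above gains nothing over the path that stops in B. -/
theorem lds_closed_path_peak (hA : A ≠ []) (hAB : ∀ a ∈ A, ∀ b ∈ B, a < b)
    (hAm : ∀ a ∈ A, a < m') (hB : ∀ b ∈ B, b < m') (hm : m' < m) (he : m' < e) :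
    lds (path (m :: (A ++ m' :: B ++ [e]))) =
      max (lds (path (m :: (A ++ [m'])))) (2 + lds (path (m' :: B))) := by
  obtain ⟨x, hx, hp⟩ := path_cons_append (a := m) hA
  have hy := List.getLast_mem hA
  set y := A.getLast hA
  have hz := List.getLast_mem (List.cons_ne_nil m' B)
  have hq := path_append_singleton (List.cons_ne_nil m' B) e
  set z := (m' :: B).getLast (List.cons_ne_nil m' B)
  have hz' : z ≤ m' ∧ ∀ a ∈ A, a < z := by
    rcases List.mem_cons.1 hz with h | h
    · exact ⟨h.le, fun a ha => h ▸ hAm a ha⟩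
    · exact ⟨(hB _ h).le, fun a ha => hAB a ha _ h⟩
  have hV : ∀ p ∈ path (m' :: B), (∀ a ∈ A, a < p.1) ∧ p.1 < m ∧ (∀ a ∈ A, a < p.2) ∧ p.2 < m' := by
    intro p h
    have h := mem_path_cons h
    refine ⟨fun a ha => ?_, ?_, fun a ha => hAB a ha _ h.2, hB _ h.2⟩ <;>
      rcases List.mem_cons.1 h.1 with h' | h'
    · have := hAm a ha; omega
    · exact hAB a ha _ h'
    · omega
    · have := hB _ h'; omega
  have e1 : path (m :: (A ++ m' :: B ++ [e])) =
      path (m :: (A ++ [m'])) ∪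
        insert (m, x) (insert (y, m') (insert (z, e) (path (m' :: B)))) := by
    rw [List.append_assoc, List.cons_append, hp, hp, path_append_cons, ← List.cons_append, hq,
      path_append_singleton hA]
    ext p; simp only [Finset.mem_insert, Finset.mem_union]; tauto
  have hxm := hAm x hx
  have hym := hAm y hy
  have hyz := hz'.2 y hy
  rw [e1, lds_union_of_incomparable, lds_insert_last, lds_insert_insert, ← add_assoc]
  · apply lds_insert_first
    intro s hs
    have h := hV s hs
    have := h.1 y hy
    simp only [NorthWest]; omega
  · simp only [NorthWest]; omega
  · intro s hs
    simp only [Finset.mem_insert] at hs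
    rcases hs with rfl | rfl | hs
    · simp only [NorthWest]; omega
    · simp only [NorthWest]; omega
    · have h := hV s hs
      have := h.2.2.1 x hx
      simp only [NorthWest]; omega
  · intro s hs hs' t ht ht'
    rw [hp, path_append_singleton hA] at hs ht'
    simp only [Finset.mem_insert, not_or] at hs hs' ht ht'
    have hsA : s ∈ path A := by tauto
    have h1 := mem_path hsA
    have h3 := hAm _ h1.2
    have htV : t = (z, e) ∨ t ∈ path (m' :: B) := by tauto
    rcases htV with rfl | htV
    · have := hz'.2 _ h1.1
      simp only [NorthWest]; omega
    have h2 := hV t htV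
    have := h2.1 _ h1.1
    have := h2.2.2.1 _ h1.2
    simp only [NorthWest]; omega

/-- Without an edge from above into A, chains of m' B are extended only by (y, m'), so the gain is
1. -/
theorem lds_open_path_peak (hA : A ≠ []) (hAB : ∀ a ∈ A, ∀ b ∈ B, a < b)
    (hAm : ∀ a ∈ A, a < m') (hB : ∀ b ∈ B, b < m') (he : m' < e) :
    lds (path (A ++ m' :: B ++ [e])) =
      max (lds (path (A ++ [m']))) (1 + lds (path (m' :: B))) := by
  have hy := List.getLast_mem hA
  set y := A.getLast hA
  have hz := List.getLast_mem (List.cons_ne_nil m' B)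
  have hq := path_append_singleton (List.cons_ne_nil m' B) e
  set z := (m' :: B).getLast (List.cons_ne_nil m' B)
  have hz' : ∀ a ∈ A, a < z := by
    rcases List.mem_cons.1 hz with h | h
    · exact fun a ha => h ▸ hAm a ha
    · exact fun a ha => hAB a ha _ h
  have hV : ∀ p ∈ path (m' :: B), (∀ a ∈ A, a < p.1) ∧ (∀ a ∈ A, a < p.2) ∧ p.2 < m' := by
    intro p h
    have h := mem_path_cons h
    refine ⟨fun a ha => ?_, fun a ha => hAB a ha _ h.2, hB _ h.2⟩
    rcases List.mem_cons.1 h.1 with h' | h'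
    · have := hAm a ha; omega
    · exact hAB a ha _ h'
  have e1 : path (A ++ m' :: B ++ [e]) =
      path (A ++ [m']) ∪ insert (y, m') (insert (z, e) (path (m' :: B))) := by
    rw [List.append_assoc, List.cons_append, path_append_cons, ← List.cons_append, hq,
      path_append_singleton hA]
    ext p; simp only [Finset.mem_insert, Finset.mem_union]; tauto
  have hym := hAm y hy
  have hyz := hz' y hy
  rw [e1, lds_union_of_incomparable, lds_insert_insert]
  · apply lds_insert_first
    intro s hs
    have h := hV s hs
    have := h.1 y hy
    simp only [NorthWest]; omega
  · simp only [NorthWest]; omega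
  · intro s hs hs' t ht ht'
    rw [path_append_singleton hA] at hs ht'
    simp only [Finset.mem_insert, not_or] at hs hs' ht ht'
    have hsA : s ∈ path A := by tauto
    have h1 := mem_path hsA
    have h3 := hAm _ h1.2
    have htV : t = (z, e) ∨ t ∈ path (m' :: B) := by tauto
    rcases htV with rfl | htV
    · have := hz' _ h1.1
      simp only [NorthWest]; omega
    have h2 := hV t htV
    have := h2.1 _ h1.1
    have := h2.2.1 _ h1.2
    simp only [NorthWest]; omega

theorem lds_descending_path_peak_of_nil (hB : ∀ b ∈ B, b < m') (hm : m' < m) (he : e < m') :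
    lds (path (m :: ([] ++ m' :: B ++ [e]))) = lds (path (m' :: (B ++ [e]))) := by
  have hq := path_append_singleton (List.cons_ne_nil m' B) e
  have e1 : path (m :: ([] ++ m' :: B ++ [e])) = {(m, m')} ∪ path (m' :: (B ++ [e])) := by
    simp only [List.nil_append, List.cons_append, path, Finset.insert_eq]
  rw [e1, lds_union_of_incomparable, lds_singleton, max_eq_right]
  · rw [← List.cons_append, hq]
    exact (lds_singleton _).symm.le.trans (lds_mono (Finset.singleton_subset_iff.2
      (Finset.mem_insert_self _ _)))
  · intro s hs _ t ht _
    rw [Finset.mem_singleton] at hs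
    subst hs
    have h1 := (mem_path_cons ht).2
    have : t.1 ≤ m' := by
      rw [← List.cons_append] at ht
      rcases List.mem_cons.1 (mem_path_append_singleton ht) with h | h
      · exact h.le
      · exact (hB _ h).le
    have : t.2 < m' := by
      rcases List.mem_append.1 h1 with h | h
      · exact hB _ h
      · rw [List.mem_singleton.1 h]; exact he
    simp only [NorthWest]; omega

/-- The edge (z, e) now goes down and is southeast of the path through A m', but southwest of (m,
x). A chain ends with at most one of these two edges, which produces the three competing terms. -/
theorem lds_descending_path_peak (hA : A ≠ []) (hAB : ∀ a ∈ A, ∀ b ∈ B, a < b)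
    (hAm : ∀ a ∈ A, a < m') (hB : ∀ b ∈ B, b < m') (hm : m' < m) (heA : ∀ a ∈ A, e < a) :
    lds (path (m :: (A ++ m' :: B ++ [e]))) =
      max (max (lds (path (m :: (A ++ [m'])))) (1 + lds (path (A ++ [m']))))
        (2 + lds (path (m' :: B))) := by
  obtain ⟨x, hx, hp⟩ := path_cons_append (a := m) hA
  have hy := List.getLast_mem hA
  set y := A.getLast hA
  have hz := List.getLast_mem (List.cons_ne_nil m' B)
  have hq := path_append_singleton (List.cons_ne_nil m' B) e
  set z := (m' :: B).getLast (List.cons_ne_nil m' B)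
  have hz' : z ≤ m' ∧ ∀ a ∈ A, a < z := by
    rcases List.mem_cons.1 hz with h | h
    · exact ⟨h.le, fun a ha => h ▸ hAm a ha⟩
    · exact ⟨(hB _ h).le, fun a ha => hAB a ha _ h⟩
  have hV : ∀ p ∈ path (m' :: B), (∀ a ∈ A, a < p.1) ∧ p.1 < m ∧ (∀ a ∈ A, a < p.2) ∧ p.2 < m' := by
    intro p h
    have h := mem_path_cons h
    refine ⟨fun a ha => ?_, ?_, fun a ha => hAB a ha _ h.2, hB _ h.2⟩ <;>
      rcases List.mem_cons.1 h.1 with h' | h'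
    · have := hAm a ha; omega
    · exact hAB a ha _ h'
    · omega
    · have := hB _ h'; omega
  have hW : ∀ p ∈ path (A ++ [m']), p.1 ∈ A ∧ (p.2 ∈ A ∨ p.2 = m') := by
    intro p h
    rw [path_append_singleton hA] at h
    rcases Finset.mem_insert.1 h with rfl | h
    · exact ⟨hy, Or.inr rfl⟩
    · exact ⟨(mem_path h).1, Or.inl (mem_path h).2⟩
  have e1 : path (m :: (A ++ m' :: B ++ [e])) =
      (path (m :: (A ++ [m'])) ∪ insert (z, e) (path (A ++ [m']))) ∪
        insert (y, m') (insert (m, x) (insert (z, e) (path (m' :: B)))) := by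
    rw [List.append_assoc, List.cons_append, hp, hp, path_append_cons, ← List.cons_append, hq,
      path_append_singleton hA]
    ext p; simp only [Finset.mem_insert, Finset.mem_union]; tauto
  have hxm := hAm x hx
  have hym := hAm y hy
  have hyz := hz'.2 y hy
  have hex := heA x hx
  have hey := heA y hy
  rw [e1, lds_union_of_incomparable, lds_union_of_incomparable, lds_insert_last,
    lds_insert_first, lds_insert_insert, ← add_assoc]
  · apply lds_insert_last
    intro s hs
    have h := hV s hs
    have := h.2.2.1 x hx
    simp only [NorthWest]; omega
  · simp only [NorthWest]; omega
  · intro s hs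
    simp only [Finset.mem_insert] at hs
    rcases hs with rfl | rfl | hs
    · simp only [NorthWest]; omega
    · simp only [NorthWest]; omega
    · have h := hV s hs
      have := h.1 y hy
      simp only [NorthWest]; omega
  · intro s hs
    have h := hW s hs
    have := hz'.2 _ h.1
    rcases h.2 with h | h
    · have := heA _ h
      simp only [NorthWest]; omega
    · simp only [NorthWest]; omega
  · intro s hs hs' t ht ht'
    rw [hp] at hs ht'
    simp only [Finset.mem_insert, not_or] at hs hs' ht ht'
    have h1 : s = (m, x) := by tauto
    have h2 : t = (z, e) := by tauto
    subst h1 h2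
    simp only [NorthWest]; omega
  · intro s hs hs' t ht ht'
    rw [hp, path_append_singleton hA] at hs ht'
    simp only [Finset.mem_insert, Finset.mem_union, not_or] at hs hs' ht ht'
    have hsA : s ∈ path A := by tauto
    have htV : t ∈ path (m' :: B) := by tauto
    have h1 := mem_path hsA
    have h2 := hV t htV
    have := h2.1 _ h1.1
    have := h2.2.2.1 _ h1.2
    simp only [NorthWest]; omega

/-! ### Chains in the path of a word decomposed into blocks -/

theorem lds_path_single_block {p : ℕ} (hA : ∀ a ∈ A, p < a ∧ a < m) (hp : p < m) (he : e < m) :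
    lds (path (p :: m :: (A ++ [e]))) = 1 + lds (path (m :: (A ++ [e]))) := by
  simp only [path]
  apply lds_insert_first
  intro s hs
  have h := mem_path_cons hs
  have h1 : p < s.1 := by
    rw [← List.cons_append] at hs
    rcases List.mem_cons.1 (mem_path_append_singleton hs) with h | h
    · omega
    · exact (hA _ h).1
  have h2 : s.2 < m := by
    rcases List.mem_append.1 h.2 with h | h
    · exact (hA _ h).2
    · rw [List.mem_singleton.1 h]; exact he
  exact ⟨h1, h2⟩

/-- The entering edge (p, m) is northwest of the path in the block, and the final edge (z, e) of the
whole word is southeast of it, whence the 2. Later blocks lie northeast. The witness y is the last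
letter of the block, from which the next block is entered. -/
theorem lds_path_block {p : ℕ} (hA : ∀ a ∈ A, p < a ∧ a < m ∧ e < a) (hp : p < m) (he : e < m)
    (hm : m < m') (hB : ∀ b ∈ B, m < b) :
    ∃ y ∈ m :: A, lds (path (p :: m :: (A ++ m' :: (B ++ [e])))) =
      max (2 + lds (path (m :: A))) (lds (path (y :: m' :: (B ++ [e])))) := by
  have hy := List.getLast_mem (List.cons_ne_nil m A)
  have hq := path_append_singleton (List.cons_ne_nil m A) m'
  set y := (m :: A).getLast (List.cons_ne_nil m A)
  have hz := List.getLast_mem (List.cons_ne_nil m' B)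
  have hr := path_append_singleton (List.cons_ne_nil m' B) e
  set z := (m' :: B).getLast (List.cons_ne_nil m' B)
  refine ⟨y, hy, ?_⟩
  have hz' : m < z := by
    rcases List.mem_cons.1 hz with h | h
    · omega
    · exact hB _ h
  have hy' : p < y ∧ y ≤ m := by
    rcases List.mem_cons.1 hy with h | h
    · omega
    · exact ⟨(hA _ h).1, (hA _ h).2.1.le⟩
  have hV : ∀ s ∈ path (m :: A), p < s.1 ∧ s.1 ≤ m ∧ s.2 < m ∧ e < s.2 := by
    intro s h
    have h := mem_path_cons h
    have h2 := hA _ h.2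
    rcases List.mem_cons.1 h.1 with h | h
    · omega
    · have := hA _ h
      omega
  have e1 : path (p :: m :: (A ++ m' :: (B ++ [e]))) =
      insert (z, e) (insert (p, m) (insert (y, m') (path (m :: A)))) ∪
        path (y :: m' :: (B ++ [e])) := by
    have : path (p :: m :: (A ++ m' :: (B ++ [e]))) =
      insert (p, m) (path ((m :: A) ++ m' :: (B ++ [e]))) := rfl
    rw [this, path_append_cons, hq, path, ← List.cons_append, hr]
    ext p; simp only [Finset.mem_insert, Finset.mem_union]; tauto
  rw [e1, lds_union_of_incomparable, lds_insert_last, lds_insert_insert, ← add_assoc]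
  · apply lds_insert_first
    intro s hs
    have h := hV s hs
    simp only [NorthWest]; omega
  · simp only [NorthWest]; omega
  · intro s hs
    simp only [Finset.mem_insert] at hs
    rcases hs with rfl | rfl | hs
    · simp only [NorthWest]; omega
    · simp only [NorthWest]; omega
    · have h := hV s hs
      simp only [NorthWest]; omega
  · intro s hs hs' t ht ht'
    rw [path, ← List.cons_append, hr] at ht hs'
    simp only [Finset.mem_insert, not_or] at hs hs' ht ht'
    have h1 : p ≤ s.1 ∧ s.1 ≤ m ∧ s.2 ≤ m := by
      have h1 : s = (p, m) ∨ s ∈ path (m :: A) := by tauto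
      rcases h1 with rfl | h1
      · simp only; omega
      · have := hV s h1
        omega
    have h2 : t ∈ path (m' :: B) := by tauto
    have h3 := mem_path_cons h2
    have := hB _ h3.2
    have : m < t.1 := by
      rcases List.mem_cons.1 h3.1 with h | h
      · omega
      · exact hB _ h
    simp only [NorthWest]; omega

end Decomposition

/-! ### The words encoded by binary trees -/

/-- The word with letters `o, …, o + n - 1` that avoids `231` and is encoded by a binary tree with
`n` nodes: the subtrees are the parts before and after the largest letter. -/
def peakWord : BinaryTree Unit → ℕ → List ℕ
  | .nil, _ => []
  | .node _ A B, o => peakWord A o ++ (o + A.numNodes + B.numNodes) :: peakWord B (o + A.numNodes)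

/-- The word with letters `o, …, o + n - 1` that avoids `231` and is encoded by a binary tree with
`n` nodes, where the left subtree encodes the block of the first letter and the smaller letters. -/
def blockWord : BinaryTree Unit → ℕ → List ℕ
  | .nil, _ => []
  | .node _ A B, o => (o + A.numNodes) :: (peakWord A o ++ blockWord B (o + A.numNodes + 1))

/-- The lengths of the longest decreasing chains in various paths through a word. -/
structure ChainStats where
  /-- Starting above the word and ending in it. -/
  fromAbove : ℕ
  /-- Starting and ending above the word. -/
  cycle : ℕ
  /-- Starting in the word and ending above it. -/
  toAbove : ℕ
  /-- Starting above the word and ending below it. -/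
  across : ℕ

/-- The chain statistics of `peakWord t`. -/
def stats : BinaryTree Unit → ChainStats
  | .nil => ⟨0, 1, 0, 1⟩
  | .node _ A B =>
    if A = .nil then
      ⟨max 1 (stats B).fromAbove, max 2 (stats B).cycle, (stats B).cycle, (stats B).across⟩
    else
      ⟨max (stats A).cycle (2 + (stats B).fromAbove),
        max (stats A).cycle (2 + (stats B).fromAbove),
        max (stats A).toAbove (1 + (stats B).fromAbove),
        max (max (stats A).cycle (1 + (stats A).toAbove)) (2 + (stats B).fromAbove)⟩

/-- The length of the longest decreasing chain in a path from below `blockWord t` to below it. -/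
def blockStat : BinaryTree Unit → ℕ
  | .nil => 1
  | .node _ A B =>
    if B = .nil then 1 + (stats A).across
    else max (2 + (stats A).fromAbove) (blockStat B)

theorem mem_peakWord {t : BinaryTree Unit} {o x : ℕ} :
    x ∈ peakWord t o ↔ o ≤ x ∧ x < o + t.numNodes := by
  induction t generalizing o with
  | nil => simp [peakWord]
  | node _ A B hA hB =>
    simp only [peakWord, List.mem_append, List.mem_cons, hA, hB, BinaryTree.numNodes]
    omega

theorem mem_blockWord {t : BinaryTree Unit} {o x : ℕ} :
    x ∈ blockWord t o ↔ o ≤ x ∧ x < o + t.numNodes := by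
  induction t generalizing o with
  | nil => simp [blockWord]
  | node _ A B hA hB =>
    simp only [blockWord, List.mem_append, List.mem_cons, mem_peakWord, hB, BinaryTree.numNodes]
    omega

theorem length_peakWord (t : BinaryTree Unit) (o : ℕ) : (peakWord t o).length = t.numNodes := by
  induction t generalizing o with
  | nil => rfl
  | node _ A B hA hB =>
    simp only [peakWord, List.length_append, List.length_cons, hA, hB, BinaryTree.numNodes]
    omega

theorem nodup_peakWord (t : BinaryTree Unit) (o : ℕ) : (peakWord t o).Nodup := by
  induction t generalizing o with
  | nil => simp [peakWord]
  | node _ A B hA hB =>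
    rw [peakWord, List.nodup_append]
    refine ⟨hA o, ?_, ?_⟩
    · rw [List.nodup_cons, mem_peakWord]
      exact ⟨by omega, hB _⟩
    · intro a ha b hb
      rw [List.mem_cons, mem_peakWord] at hb
      rw [mem_peakWord] at ha
      omega

theorem nodup_blockWord (t : BinaryTree Unit) (o : ℕ) : (blockWord t o).Nodup := by
  induction t generalizing o with
  | nil => simp [blockWord]
  | node _ A B hA hB =>
    rw [blockWord, List.nodup_cons, List.nodup_append, List.mem_append, mem_peakWord,
      mem_blockWord]
    refine ⟨by omega, nodup_peakWord _ _, hB _, ?_⟩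
    intro a ha b hb
    rw [mem_blockWord] at hb
    rw [mem_peakWord] at ha
    omega

theorem peakWord_ne_nil {t : BinaryTree Unit} (h : t ≠ .nil) (o : ℕ) : peakWord t o ≠ [] := by
  cases t with
  | nil => exact absurd rfl h
  | node _ A B => simp [peakWord]

/-! ### Chain statistics of the words -/

/-- The three values need a joint induction: the peak serves as the outer letter e for A and m for
B, so each recursion calls the others. -/
theorem lds_path_peakWord (t : BinaryTree Unit) :
    ∀ o m e, o + t.numNodes ≤ m → o + t.numNodes ≤ e →
      lds (path (m :: peakWord t o)) = (stats t).fromAbove ∧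
      lds (path (m :: (peakWord t o ++ [e]))) = (stats t).cycle ∧
      lds (path (peakWord t o ++ [e])) = (stats t).toAbove := by
  induction t with
  | nil => simp [peakWord, path, stats]
  | node _ A B hA hB =>
    intro o m e hm he
    rw [BinaryTree.numNodes] at hm he
    have hBA := fun m e => hB (o + A.numNodes) m e
    have hbm : ∀ b ∈ peakWord B (o + A.numNodes), b < o + A.numNodes + B.numNodes := by
      intro b hb
      rw [mem_peakWord] at hb
      omega
    have h1 := hBA (o + A.numNodes + B.numNodes) e le_rfl (by omega)
    by_cases h : A = .nil
    · subst h
      simp only [BinaryTree.numNodes, stats, if_true, peakWord] at *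
      refine ⟨?_, ?_, ?_⟩
      · rw [lds_path_peak_of_nil hbm (by omega), h1.1]
      · rw [lds_closed_path_peak_of_nil hbm (by omega) (by omega), h1.2.1]
      · exact h1.2.1
    · simp only [stats, if_neg h, peakWord]
      have h2 := hA o m (o + A.numNodes + B.numNodes) (by omega) (by omega)
      have hab : ∀ a ∈ peakWord A o, ∀ b ∈ peakWord B (o + A.numNodes), a < b := by
        intro a ha b hb
        rw [mem_peakWord] at ha hb
        omega
      have ham : ∀ a ∈ peakWord A o, a < o + A.numNodes + B.numNodes := by
        intro a ha
        rw [mem_peakWord] at ha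
        omega
      have hn := peakWord_ne_nil h o
      refine ⟨?_, ?_, ?_⟩
      · rw [lds_path_peak hn hab ham hbm (by omega), h1.1, h2.2.1]
      · rw [lds_closed_path_peak hn hab ham hbm (by omega) (by omega), h1.1, h2.2.1]
      · rw [lds_open_path_peak hn hab ham hbm (by omega), h1.1, h2.2.2]

theorem lds_path_peakWord_across (t : BinaryTree Unit) :
    ∀ o m e, o + t.numNodes ≤ m → e < o → lds (path (m :: (peakWord t o ++ [e]))) =
      (stats t).across := by
  induction t with
  | nil => simp [peakWord, path, stats]
  | node _ A B hA hB =>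
    intro o m e hm he
    rw [BinaryTree.numNodes] at hm
    have hbm : ∀ b ∈ peakWord B (o + A.numNodes), b < o + A.numNodes + B.numNodes := by
      intro b hb
      rw [mem_peakWord] at hb
      omega
    by_cases h : A = .nil
    · subst h
      simp only [BinaryTree.numNodes, stats, if_true, peakWord] at *
      rw [lds_descending_path_peak_of_nil hbm (by omega) (by omega), hB _ _ _ le_rfl (by omega)]
    · simp only [stats, if_neg h, peakWord]
      have h2 := lds_path_peakWord A o m (o + A.numNodes + B.numNodes) (by omega) (by omega)
      have h1 := lds_path_peakWord B (o + A.numNodes) (o + A.numNodes + B.numNodes) m le_rfl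
        (by omega)
      rw [lds_descending_path_peak (peakWord_ne_nil h o) _ _ hbm (by omega), h1.1, h2.2.1, h2.2.2]
      · intro a ha
        rw [mem_peakWord] at ha
        omega
      · intro a ha b hb
        rw [mem_peakWord] at ha hb
        omega
      · intro a ha
        rw [mem_peakWord] at ha
        omega

/-- The start p must vary: in the recursion the last letter of one block becomes the start for the
next, while the end e stays fixed. -/
theorem lds_path_blockWord (t : BinaryTree Unit) :
    ∀ o p e, p < o → e < o → lds (path (p :: (blockWord t o ++ [e]))) = blockStat t := by
  induction t with
  | nil => simp [blockWord, path, blockStat]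
  | node _ A B _ hB =>
    intro o p e hp he
    rw [blockWord]
    by_cases h : B = .nil
    · subst h
      simp only [blockStat, if_true, blockWord, List.append_nil, List.cons_append]
      rw [lds_path_single_block _ (by omega) (by omega),
        lds_path_peakWord_across _ _ _ _ le_rfl he]
      intro a ha
      rw [mem_peakWord] at ha
      omega
    · rw [blockStat, if_neg h]
      obtain ⟨m', C, hC⟩ : ∃ m' C, blockWord B (o + A.numNodes + 1) = m' :: C := by
        cases B with
        | nil => exact absurd rfl h
        | node _ B B' => exact ⟨_, _, rfl⟩
      have hmem : ∀ x ∈ m' :: C, o + A.numNodes < x := by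
        intro x hx
        rw [← hC, mem_blockWord] at hx
        omega
      have hA : ∀ a ∈ peakWord A o, p < a ∧ a < o + A.numNodes ∧ e < a := by
        intro a ha
        rw [mem_peakWord] at ha
        omega
      obtain ⟨y, hy, hl⟩ := lds_path_block (p := p) (e := e) hA (by omega) (by omega)
        (hmem m' (by simp)) (fun b hb => hmem b (List.mem_cons_of_mem _ hb))
      rw [hC, List.cons_append, List.append_assoc, List.cons_append, hl]
      have hyo : y < o + A.numNodes + 1 := by
        rcases List.mem_cons.1 hy with h | h
        · omega
        · have := hA y h
          omega
      have := hB (o + A.numNodes + 1) y e hyo (by omega)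
      rw [hC, List.cons_append] at this
      rw [this, (lds_path_peakWord A o _ (o + A.numNodes) le_rfl le_rfl).1]

/-! ### The words encoded by trees are exactly the words avoiding `231` -/

/-- The list `l` has no subsequence in the same relative order as `231`. -/
def ListAvoids231 (l : List ℕ) : Prop := ∀ a b c, [a, b, c].Sublist l → ¬ (c < a ∧ a < b)

theorem ListAvoids231.sublist {l l' : List ℕ} (h : ListAvoids231 l) (hl : l'.Sublist l) :
    ListAvoids231 l' := fun a b c hs => h a b c (hs.trans hl)

theorem listAvoids231_nil : ListAvoids231 [] := by
  intro a b c h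
  simp at h

theorem listAvoids231_append_of_lt {A B : List ℕ} (hA : ListAvoids231 A) (hB : ListAvoids231 B)
    (h : ∀ a ∈ A, ∀ b ∈ B, a < b) : ListAvoids231 (A ++ B) := by
  intro a b c hs
  obtain ⟨l1, l2, he, h1, h2⟩ := List.sublist_append_iff.1 hs
  match l1, l2, he with
  | [], _, he =>
    simp only [List.nil_append] at he
    exact hB a b c (he ▸ h2)
  | _, [], he =>
    simp only [List.append_nil] at he
    exact hA a b c (he ▸ h1)
  | [x], [y, z], he =>
    simp only [List.cons_append, List.nil_append, List.cons.injEq] at he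
    have := h x (h1.subset (by simp)) z (h2.subset (by simp))
    omega
  | [x, y], [z], he =>
    simp only [List.cons_append, List.nil_append, List.cons.injEq] at he
    have := h x (h1.subset (by simp)) z (h2.subset (by simp))
    omega
  | _ :: _ :: _ :: _, _ :: _, he => simp at he
  | [_], _ :: _ :: _ :: _, he => simp at he
  | [_], [_], he => simp at he
  | [_, _], _ :: _ :: _, he => simp at he

theorem listAvoids231_cons_of_forall_lt {m : ℕ} {B : List ℕ} (hB : ListAvoids231 B)
    (h : ∀ b ∈ B, b < m) : ListAvoids231 (m :: B) := by
  intro a b c hs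
  rcases List.sublist_cons_iff.1 hs with h' | ⟨r, hr, h'⟩
  · exact hB a b c h'
  · simp only [List.cons.injEq] at hr
    have := h b (h'.subset (by simp [← hr.2]))
    omega

theorem listAvoids231_peakWord (t : BinaryTree Unit) (o : ℕ) : ListAvoids231 (peakWord t o) := by
  induction t generalizing o with
  | nil => exact listAvoids231_nil
  | node _ A B hA hB =>
    refine listAvoids231_append_of_lt (hA o) (listAvoids231_cons_of_forall_lt (hB _) ?_) ?_
    · intro b hb
      rw [mem_peakWord] at hb
      omega
    · intro a ha b hb
      rw [List.mem_cons, mem_peakWord] at hb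
      rw [mem_peakWord] at ha
      omega

theorem listAvoids231_blockWord (t : BinaryTree Unit) (o : ℕ) : ListAvoids231 (blockWord t o) := by
  induction t generalizing o with
  | nil => exact listAvoids231_nil
  | node _ A B hA hB =>
    rw [blockWord, ← List.cons_append]
    refine listAvoids231_append_of_lt
      (listAvoids231_cons_of_forall_lt (listAvoids231_peakWord A o) ?_) (hB _) ?_
    · intro b hb
      rw [mem_peakWord] at hb
      omega
    · intro a ha b hb
      rw [List.mem_cons, mem_peakWord] at ha
      rw [mem_blockWord] at hb
      omega

/-- The length fixes the value of the peak, which occurs only once, so the cut is unique. -/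
theorem peakWord_injective (o : ℕ) : ∀ t t', peakWord t o = peakWord t' o → t = t' := by
  intro t
  induction t generalizing o with
  | nil =>
    intro t' h
    by_contra hne
    exact peakWord_ne_nil (Ne.symm hne) o h.symm
  | node _ A B hA hB =>
    intro t' h
    cases t' with
    | nil => simp [peakWord] at h
    | node _ A' B' =>
      have hl := congrArg List.length h
      rw [length_peakWord, length_peakWord, BinaryTree.numNodes, BinaryTree.numNodes] at hl
      rw [peakWord, peakWord, show o + A'.numNodes + B'.numNodes = o + A.numNodes + B.numNodes by
        omega] at h
      obtain ⟨h1, -, h2⟩ := (List.append_cons_inj_of_notMem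
        (by rw [mem_peakWord]; omega) (by rw [mem_peakWord]; omega)).1 h
      have := hA o A' h1
      subst this
      rw [hB _ B' h2]

theorem blockWord_injective (o : ℕ) : ∀ t t', blockWord t o = blockWord t' o → t = t' := by
  intro t
  induction t generalizing o with
  | nil =>
    intro t' h
    cases t' with
    | nil => rfl
    | node _ A' B' => simp [blockWord] at h
  | node _ A B hA hB =>
    intro t' h
    cases t' with
    | nil => simp [blockWord] at h
    | node _ A' B' =>
      rw [blockWord, blockWord, List.cons.injEq] at h
      have hl : A.numNodes = A'.numNodes := by omega
      obtain ⟨h1, h2⟩ := List.append_inj h.2 (by rw [length_peakWord, length_peakWord, hl])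
      have := peakWord_injective o _ _ h1
      subst this
      rw [hB _ B' h2]

/-- The lists that use each of the letters `o, …, o + n - 1` once. -/
def IsWord (o n : ℕ) (l : List ℕ) : Prop := l.Nodup ∧ ∀ x, x ∈ l ↔ o ≤ x ∧ x < o + n

theorem IsWord.length_eq {o n : ℕ} {l : List ℕ} (h : IsWord o n l) : l.length = n := by
  rw [← List.toFinset_card_of_nodup h.1]
  have : l.toFinset = Finset.Ico o (o + n) := by
    ext x
    simp [h.2]
  simp [this]

/-- If two complementary parts of an interval are separated, then both are intervals. -/
theorem exists_isWord_of_lt {o n : ℕ} {A B : List ℕ} (hA : A.Nodup) (hB : B.Nodup)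
    (h : ∀ a ∈ A, ∀ b ∈ B, a < b) (hx : ∀ x, (x ∈ A ∨ x ∈ B) ↔ o ≤ x ∧ x < o + n) :
    ∃ i j, i + j = n ∧ IsWord o i A ∧ IsWord (o + i) j B := by
  -- The threshold is the least letter of B, or the end of the interval if B is empty.
  have key : ∃ i ≤ n, ∀ x, o ≤ x → x < o + n → (x ∈ A ↔ x < o + i) := by
    by_cases hn : ∃ i, i < n ∧ o + i ∈ B
    · classical
      refine ⟨Nat.find hn, (Nat.find_spec hn).1.le, fun x h1 h2 => ?_⟩
      constructor
      · intro hxA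
        exact h x hxA _ (Nat.find_spec hn).2
      · intro hlt
        refine ((hx x).2 ⟨h1, h2⟩).resolve_right fun hxB => ?_
        exact Nat.find_min hn (m := x - o) (by omega)
          ⟨by omega, by rwa [Nat.add_sub_cancel' h1]⟩
    · push Not at hn
      refine ⟨n, le_rfl, fun x h1 h2 => ⟨fun _ => h2, fun _ => ?_⟩⟩
      refine ((hx x).2 ⟨h1, h2⟩).resolve_right fun hxB => ?_
      exact hn (x - o) (by omega) (by rwa [Nat.add_sub_cancel' h1])
  obtain ⟨i, hi, hk⟩ := key
  refine ⟨i, n - i, by omega, ⟨hA, fun x => ?_⟩, ⟨hB, fun x => ?_⟩⟩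
  · constructor
    · intro hxA
      have h1 := (hx x).1 (Or.inl hxA)
      exact ⟨h1.1, (hk x h1.1 h1.2).1 hxA⟩
    · rintro ⟨h1, h2⟩
      exact (hk x h1 (by omega)).2 h2
  · constructor
    · intro hxB
      have h1 := (hx x).1 (Or.inr hxB)
      refine ⟨?_, by omega⟩
      by_contra! hlt
      exact absurd (h x ((hk x h1.1 h1.2).2 hlt) x hxB) (lt_irrefl _)
    · rintro ⟨h1, h2⟩
      refine ((hx x).2 ⟨by omega, by omega⟩).resolve_left fun hxA => ?_
      have := (hk x (by omega) (by omega)).1 hxA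
      omega

theorem isWord_peakWord (t : BinaryTree Unit) (o : ℕ) : IsWord o t.numNodes (peakWord t o) :=
  ⟨nodup_peakWord t o, fun _ => mem_peakWord⟩

theorem isWord_blockWord (t : BinaryTree Unit) (o : ℕ) : IsWord o t.numNodes (blockWord t o) :=
  ⟨nodup_blockWord t o, fun _ => mem_blockWord⟩

theorem IsWord.eq_nil {o : ℕ} {l : List ℕ} (h : IsWord o 0 l) : l = [] :=
  List.length_eq_zero_iff.1 h.length_eq

theorem exists_peakWord (n : ℕ) : ∀ o l, IsWord o n l → ListAvoids231 l →
    ∃ t : BinaryTree Unit, t.numNodes = n ∧ peakWord t o = l := by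
  induction n using Nat.strong_induction_on with
  | _ n ih =>
    intro o l hl ha
    rcases n with _ | n
    · exact ⟨.nil, rfl, hl.eq_nil.symm⟩
    obtain ⟨A, B, rfl⟩ := List.append_of_mem ((hl.2 (o + n)).2 ⟨by omega, by omega⟩)
    have hnd := hl.1
    rw [List.nodup_append, List.nodup_cons] at hnd
    obtain ⟨hA, ⟨hmB, hB⟩, hAB⟩ := hnd
    have hmA : o + n ∉ A := fun h => hAB _ h (o + n) (by simp) rfl
    have hx : ∀ x, (x ∈ A ∨ x ∈ B) ↔ o ≤ x ∧ x < o + n := by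
      intro x
      have h1 := hl.2 x
      rw [List.mem_append, List.mem_cons] at h1
      constructor
      · intro h
        have hne : x ≠ o + n := by
          rintro rfl
          tauto
        have := h1.1 (by tauto)
        omega
      · intro h
        have := h1.2 (by omega)
        have : x ≠ o + n := by omega
        tauto
    -- Otherwise a, the maximum, b would form a 231.
    have hlt : ∀ a ∈ A, ∀ b ∈ B, a < b := by
      intro a haA b hbB
      have hs : [a, o + n, b].Sublist (A ++ (o + n) :: B) :=
        (List.singleton_sublist.2 haA).append
          ((List.singleton_sublist.2 hbB).cons_cons (o + n))
      have h1 := ha _ _ _ hs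
      have h2 := (hx a).1 (Or.inl haA)
      have h3 := hAB a haA b (by simp [hbB])
      omega
    obtain ⟨i, j, hij, hi, hj⟩ := exists_isWord_of_lt hA hB hlt hx
    obtain ⟨t, ht, rfl⟩ := ih i (by omega) o A hi (ha.sublist (List.sublist_append_left _ _))
    obtain ⟨s, hs, rfl⟩ := ih j (by omega) (o + i) B hj
      (ha.sublist ((List.sublist_cons_self _ _).trans (List.sublist_append_right _ _)))
    refine ⟨.node () t s, by rw [BinaryTree.numNodes]; omega, ?_⟩
    rw [peakWord, ht, hs, add_assoc, hij]

/-- A list in which no letter above `m` precedes one below `m` splits into the letters below `m`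
followed by those above `m`. -/
theorem exists_append_of_separated {m : ℕ} {l : List ℕ} (hm : m ∉ l)
    (h : ∀ b c, [b, c].Sublist l → ¬ (c < m ∧ m < b)) :
    ∃ S T, l = S ++ T ∧ (∀ x ∈ S, x < m) ∧ ∀ x ∈ T, m < x := by
  induction l with
  | nil => exact ⟨[], [], by simp⟩
  | cons a l ih =>
    rw [List.mem_cons, not_or] at hm
    by_cases hlt : a < m
    · obtain ⟨S, T, rfl, hS, hT⟩ := ih hm.2 fun b c hs => h b c (hs.cons a)
      exact ⟨a :: S, T, rfl, by simpa using ⟨hlt, hS⟩, hT⟩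
    · refine ⟨[], a :: l, rfl, by simp, ?_⟩
      intro x hx
      rcases List.mem_cons.1 hx with rfl | hx
      · omega
      · have := h a x ((List.singleton_sublist.2 hx).cons_cons a)
        have : x ≠ m := fun e => hm.2 (e ▸ hx)
        omega

theorem exists_blockWord (n : ℕ) : ∀ o l, IsWord o n l → ListAvoids231 l →
    ∃ t : BinaryTree Unit, t.numNodes = n ∧ blockWord t o = l := by
  induction n using Nat.strong_induction_on with
  | _ n ih =>
    intro o l hl ha
    rcases l with _ | ⟨m, l⟩
    · exact ⟨.nil, hl.length_eq, rfl⟩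
    have hnd := hl.1
    rw [List.nodup_cons] at hnd
    obtain ⟨S, T, rfl, hS, hT⟩ := exists_append_of_separated hnd.1
      fun b c hs h => ha m b c (hs.cons_cons m) h
    rw [List.nodup_append] at hnd
    obtain ⟨hmn, hSn, hTn, hST⟩ := hnd
    obtain ⟨i, j, hij, hi, hj⟩ := exists_isWord_of_lt (o := o) (n := n) (A := m :: S) (B := T)
      (List.nodup_cons.2 ⟨fun h => hmn (by simp [h]), hSn⟩) hTn
      (by
        intro a ha b hb
        rcases List.mem_cons.1 ha with rfl | ha
        · exact hT b hb
        · exact (hS a ha).trans (hT b hb))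
      (by
        intro x
        rw [← hl.2 x, ← List.cons_append, List.mem_append])
    have hilen := hi.length_eq
    rw [List.length_cons] at hilen
    -- The first block fills an interval and m is its largest letter.
    have hm : m = o + S.length := by
      have h1 := (hi.2 m).1 (by simp)
      have h2 := (hi.2 (o + S.length)).2 (by omega)
      rcases List.mem_cons.1 h2 with h | h
      · exact h.symm
      · have := hS _ h
        omega
    have hSw : IsWord o S.length S := by
      refine ⟨hSn, fun x => ?_⟩
      have h1 := hi.2 x
      rw [List.mem_cons] at h1
      constructor
      · intro h
        have := hS x h
        have := h1.1 (Or.inr h)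
        omega
      · intro h
        exact (h1.2 (by omega)).resolve_left (by omega)
    obtain ⟨t, ht, rfl⟩ := exists_peakWord S.length o S hSw
      (ha.sublist ((List.sublist_append_left _ _).trans (List.sublist_cons_self _ _)))
    obtain ⟨s, hs, rfl⟩ := ih j (by omega) (o + i) T hj
      (ha.sublist ((List.sublist_append_right _ _).trans (List.sublist_cons_self _ _)))
    refine ⟨.node () t s, by rw [BinaryTree.numNodes]; omega, ?_⟩
    rw [blockWord, hm, ht, ← hilen, add_assoc]

/-! ### Generating functions of binary trees -/

open Classical in
/-- The number of binary trees with `n` nodes that satisfy `p`. -/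
noncomputable def treeCount (p : BinaryTree Unit → Prop) (n : ℕ) : ℕ :=
  ((BinaryTree.treesOfNumNodesEq n).filter p).card

/-- The generating function of the binary trees that satisfy `p`, where a tree with `n` nodes
has weight `X ^ (n + 1)`. -/
noncomputable def treeGF (p : BinaryTree Unit → Prop) : ℚ⟦X⟧ :=
  PowerSeries.X * PowerSeries.mk fun n => (treeCount p n : ℚ)

theorem treeCount_eq_zero {p : BinaryTree Unit → Prop} {n : ℕ}
    (h : ∀ t : BinaryTree Unit, t.numNodes = n → ¬ p t) : treeCount p n = 0 := by
  classical
  rw [treeCount, Finset.card_eq_zero]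
  exact Finset.filter_eq_empty_iff.2 fun t ht => h t (BinaryTree.mem_treesOfNumNodesEq.1 ht)

theorem treeGF_congr {p q : BinaryTree Unit → Prop} (h : ∀ t, p t ↔ q t) :
    treeGF p = treeGF q := by
  rw [funext fun t => propext (h t)]

theorem treeGF_or {p q r : BinaryTree Unit → Prop} (h : ∀ t, p t ↔ q t ∨ r t)
    (hd : ∀ t, q t → ¬ r t) : treeGF p = treeGF q + treeGF r := by
  rw [treeGF_congr h, treeGF, treeGF, treeGF, ← mul_add]
  congr 1
  ext n
  simp only [PowerSeries.coeff_mk, map_add, treeCount]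
  classical
  rw [← Nat.cast_add, ← Finset.card_union_of_disjoint, ← Finset.filter_or]
  · congr!
  · exact Finset.disjoint_filter.2 fun t _ => hd t

theorem treeGF_eq_nil : treeGF (fun t => t = .nil) = PowerSeries.X := by
  rw [treeGF]
  convert mul_one (PowerSeries.X : ℚ⟦X⟧) using 2
  ext n
  rw [PowerSeries.coeff_mk, PowerSeries.coeff_one]
  split_ifs with hn
  · subst hn
    simp [treeCount, BinaryTree.treesOfNumNodesEq_zero, Finset.filter_singleton]
  · rw [Nat.cast_eq_zero]
    apply treeCount_eq_zero
    rintro t rfl rfl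
    exact hn rfl

theorem treeGF_false {p : BinaryTree Unit → Prop} (h : ∀ t, ¬ p t) : treeGF p = 0 := by
  have : (PowerSeries.mk fun n => (treeCount p n : ℚ)) = 0 := by
    ext n
    simp [treeCount, h]
  rw [treeGF, this, mul_zero]

theorem treeCount_node_succ {p a b : BinaryTree Unit → Prop}
    (h : ∀ A B, p (.node () A B) ↔ a A ∧ b B) (n : ℕ) :
    treeCount p (n + 1) =
      ∑ ij ∈ Finset.HasAntidiagonal.antidiagonal n, treeCount a ij.1 * treeCount b ij.2 := by
  classical
  simp only [treeCount]
  rw [BinaryTree.treesOfNumNodesEq_succ, Finset.filter_biUnion, Finset.card_biUnion]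
  · refine Finset.sum_congr rfl fun ij _ => ?_
    rw [← Finset.card_product]
    rw [Finset.filter_map, Finset.card_map]
    congr 1
    ext x
    simp only [Finset.mem_filter, Finset.mem_product, Function.comp]
    change _ ∧ p (.node () x.1 x.2) ↔ _
    rw [h]
    tauto
  · intro x hx y hy hxy
    rw [Function.onFun, Finset.disjoint_left]
    intro t ht ht'
    simp only [Finset.mem_filter, Finset.mem_map, Finset.mem_product,
      BinaryTree.mem_treesOfNumNodesEq] at ht ht'
    obtain ⟨⟨u, ⟨h1, h2⟩, rfl⟩, -⟩ := ht
    obtain ⟨⟨v, ⟨h3, h4⟩, he⟩, -⟩ := ht'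
    replace he : BinaryTree.node () v.1 v.2 = .node () u.1 u.2 := he
    rw [BinaryTree.node.injEq] at he
    exact hxy (Prod.ext (by rw [← h1, ← h3, he.2.1]) (by rw [← h2, ← h4, he.2.2]))

/-- The exponent n + 1 is additive when two trees are joined at a root, so no extra factor X
appears. -/
theorem treeGF_node {p a b : BinaryTree Unit → Prop} (h0 : ¬ p .nil)
    (h : ∀ A B, p (.node () A B) ↔ a A ∧ b B) : treeGF p = treeGF a * treeGF b := by
  rw [treeGF, treeGF, treeGF, mul_assoc, mul_left_comm (PowerSeries.mk _), ← mul_assoc, mul_assoc]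
  congr 1
  ext n
  rcases n with _ | n
  · simp [treeCount, BinaryTree.treesOfNumNodesEq_zero, Finset.filter_singleton, h0]
  · rw [PowerSeries.coeff_mk, PowerSeries.coeff_succ_X_mul, PowerSeries.coeff_mul,
      treeCount_node_succ h]
    simp

theorem treeGF_ne_nil {a : BinaryTree Unit → Prop} (h : a .nil) :
    treeGF (fun t => t ≠ .nil ∧ a t) = treeGF a - PowerSeries.X := by
  rw [eq_sub_iff_add_eq', ← treeGF_eq_nil]
  refine (treeGF_or (fun t => ?_) (fun t h h' => h'.1 h)).symm
  by_cases ht : t = .nil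
  · simp [ht, h]
  · simp [ht]

/-- The three terms count the empty tree, the trees with empty left subtree, and the others. -/
theorem treeGF_node_left {p q a b : BinaryTree Unit → Prop} (h0 : p .nil) (ha : a .nil)
    (h : ∀ A B, p (.node () A B) ↔ if A = .nil then q B else a A ∧ b B) :
    treeGF p = PowerSeries.X + PowerSeries.X * treeGF q +
      (treeGF a - PowerSeries.X) * treeGF b := by
  rw [← treeGF_ne_nil ha]
  nth_rewrite 2 [← treeGF_eq_nil]
  rw [← treeGF_node (p := fun t => ∃ B, t = .node () .nil B ∧ q B),
    ← treeGF_node (p := fun t => ∃ A B, t = .node () A B ∧ A ≠ .nil ∧ a A ∧ b B),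
    add_assoc, ← treeGF_or (p := fun t => t ≠ .nil ∧ p t), treeGF_ne_nil h0]
  · ring
  · rintro (_ | ⟨_, A, B⟩)
    · simp
    · by_cases hA : A = .nil <;> simp [h, hA]
  · rintro _ ⟨B, rfl, _⟩ ⟨A, B', h, h', _⟩
    simp only [BinaryTree.node.injEq] at h
    exact h' h.2.1.symm
  · simp
  · intro A B
    simp [and_assoc]
  · simp
  · intro A B
    simp

theorem treeGF_node_right {p q a b : BinaryTree Unit → Prop} (h0 : p .nil) (hb : b .nil)
    (h : ∀ A B, p (.node () A B) ↔ if B = .nil then q A else a A ∧ b B) :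
    treeGF p = PowerSeries.X + PowerSeries.X * treeGF q +
      treeGF a * (treeGF b - PowerSeries.X) := by
  rw [← treeGF_ne_nil hb]
  nth_rewrite 2 [← treeGF_eq_nil]
  rw [mul_comm (treeGF (fun t => t = .nil)),
    ← treeGF_node (p := fun t => ∃ A, t = .node () A .nil ∧ q A),
    ← treeGF_node (p := fun t => ∃ A B, t = .node () A B ∧ a A ∧ B ≠ .nil ∧ b B),
    add_assoc, ← treeGF_or (p := fun t => t ≠ .nil ∧ p t), treeGF_ne_nil h0]
  · ring
  · rintro (_ | ⟨_, A, B⟩)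
    · simp
    · by_cases hB : B = .nil <;> simp [h, hB]
  · rintro _ ⟨B, rfl, _⟩ ⟨A, B', h, _, h', _⟩
    simp only [BinaryTree.node.injEq] at h
    exact h' h.2.2.symm
  · simp
  · intro A B
    simp
  · simp
  · intro A B
    simp [and_comm]

/-! ### The equations between the generating functions -/

/-- Trees by the statistic `cycle`. -/
noncomputable def cycleGF (k : ℕ) : ℚ⟦X⟧ := treeGF fun t => (stats t).cycle < k

/-- Trees by the statistic `fromAbove`. -/
noncomputable def fromAboveGF (k : ℕ) : ℚ⟦X⟧ := treeGF fun t => (stats t).fromAbove < k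

/-- Trees by the statistics `cycle` and `toAbove`. -/
noncomputable def cycleToAboveGF (k : ℕ) : ℚ⟦X⟧ :=
  treeGF fun t => (stats t).cycle < k ∧ 1 + (stats t).toAbove < k

/-- Trees by the statistic `across`. -/
noncomputable def acrossGF (k : ℕ) : ℚ⟦X⟧ := treeGF fun t => 1 + (stats t).across < k

/-- Trees by the statistic `blockStat`. -/
noncomputable def blockGF (k : ℕ) : ℚ⟦X⟧ := treeGF fun t => blockStat t < k

theorem one_le_cycle (t : BinaryTree Unit) : 1 ≤ (stats t).cycle := by
  cases t with
  | nil => exact le_rfl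
  | node _ A B => rw [stats]; split_ifs <;> simp only <;> omega

theorem one_le_across (t : BinaryTree Unit) : 1 ≤ (stats t).across := by
  induction t with
  | nil => exact le_rfl
  | node _ A B _ hB => rw [stats]; split_ifs <;> simp only <;> omega

theorem one_le_blockStat (t : BinaryTree Unit) : 1 ≤ blockStat t := by
  cases t with
  | nil => exact le_rfl
  | node _ A B => rw [blockStat]; split_ifs <;> omega

theorem fromAboveGF_zero : fromAboveGF 0 = 0 := treeGF_false fun t => by simp

theorem fromAboveGF_one : fromAboveGF 1 = PowerSeries.X := by
  rw [← treeGF_eq_nil]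
  refine treeGF_congr fun t => ?_
  cases t with
  | nil => simp [stats]
  | node _ A B =>
    simp only [reduceCtorEq, iff_false]
    have := one_le_cycle A
    rw [stats]; split_ifs <;> simp only <;> omega

theorem cycleGF_two : cycleGF 2 = PowerSeries.X := by
  rw [← treeGF_eq_nil]
  refine treeGF_congr fun t => ?_
  cases t with
  | nil => simp [stats]
  | node _ A B =>
    simp only [reduceCtorEq, iff_false]
    rw [stats]; split_ifs <;> simp only <;> omega

theorem blockGF_one : blockGF 1 = 0 :=
  treeGF_false fun t => by have := one_le_blockStat t; omega

theorem blockGF_two : blockGF 2 = PowerSeries.X := by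
  rw [← treeGF_eq_nil]
  refine treeGF_congr fun t => ?_
  cases t with
  | nil => simp [blockStat]
  | node _ A B =>
    simp only [reduceCtorEq, iff_false]
    have := one_le_across A
    rw [blockStat]; split_ifs <;> omega

theorem cycleGF_eq (k : ℕ) : cycleGF (k + 3) = PowerSeries.X + PowerSeries.X * cycleGF (k + 3) +
    (cycleGF (k + 3) - PowerSeries.X) * fromAboveGF (k + 1) := by
  refine treeGF_node_left (by simp [stats]) (by simp [stats]) fun A B => ?_
  rw [stats]; split_ifs <;> simp only <;> omega

theorem fromAboveGF_eq (k : ℕ) : fromAboveGF (k + 2) =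
    PowerSeries.X + PowerSeries.X * fromAboveGF (k + 2) +
    (cycleGF (k + 2) - PowerSeries.X) * fromAboveGF k := by
  refine treeGF_node_left (by simp [stats]) (by simp [stats]) fun A B => ?_
  rw [stats]; split_ifs <;> simp only <;> omega

theorem cycleToAboveGF_eq (k : ℕ) : cycleToAboveGF (k + 2) =
    PowerSeries.X + PowerSeries.X * cycleGF (k + 1) +
    (cycleToAboveGF (k + 2) - PowerSeries.X) * fromAboveGF k := by
  refine treeGF_node_left (by simp [stats]) (by simp [stats]) fun A B => ?_
  -- For an empty left subtree this makes the clause from `max 2` follow from the condition on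
  -- `toAbove`.
  have := one_le_cycle B
  rw [stats]; split_ifs <;> simp only <;> omega

theorem acrossGF_eq (k : ℕ) : acrossGF (k + 3) =
    PowerSeries.X + PowerSeries.X * acrossGF (k + 3) +
    (cycleToAboveGF (k + 2) - PowerSeries.X) * fromAboveGF k := by
  refine treeGF_node_left (by simp [stats]) (by simp [stats]) fun A B => ?_
  rw [stats]
  split_ifs
  · exact Iff.rfl
  · simp only
    omega

theorem blockGF_eq (k : ℕ) : blockGF (k + 2) =
    PowerSeries.X + PowerSeries.X * acrossGF (k + 2) +
    fromAboveGF k * (blockGF (k + 2) - PowerSeries.X) := by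
  refine treeGF_node_right (by simp [blockStat]) (by simp [blockStat]) fun A B => ?_
  rw [blockStat]; split_ifs <;> omega

/-! ### Solving the equations -/

theorem one_sub_ne_zero_of_constantCoeff {f : ℚ⟦X⟧} (h : PowerSeries.constantCoeff f = 0) :
    1 - f ≠ 0 := by
  intro h0
  have := congrArg PowerSeries.constantCoeff h0
  simp [h] at this

theorem constantCoeff_treeGF (p : BinaryTree Unit → Prop) :
    PowerSeries.constantCoeff (treeGF p) = 0 := by
  simp [treeGF]

theorem one_sub_X_ne_zero : (1 - PowerSeries.X : ℚ⟦X⟧) ≠ 0 :=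
  one_sub_ne_zero_of_constantCoeff (by simp)

theorem one_sub_fromAboveGF_ne_zero (k : ℕ) : 1 - fromAboveGF k ≠ 0 :=
  one_sub_ne_zero_of_constantCoeff (constantCoeff_treeGF _)

/-- From threshold 3 on, the terms `max 2` and `max 1` are vacuous and both series solve the same
linear equation. -/
theorem cycleGF_eq_fromAboveGF (k : ℕ) : cycleGF (k + 3) = fromAboveGF (k + 3) := by
  apply mul_right_cancel₀ one_sub_X_ne_zero
  linear_combination cycleGF_eq k - fromAboveGF_eq (k + 1)

/-- The recursion reads F_{k+3}(1 - X - F_{k+1}) = X(1 - F_{k+1}); replacing the X inside the left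
bracket by F_{k+2}(1 - F_{k+1}) leaves a factor 1 - F_{k+1} to cancel. -/
theorem fromAboveGF_succ_mul (k : ℕ) : fromAboveGF (k + 1) * (1 - fromAboveGF k) =
    PowerSeries.X := by
  induction k with
  | zero => rw [fromAboveGF_zero, fromAboveGF_one, sub_zero, mul_one]
  | succ k ih =>
    rcases k with _ | k
    · have := fromAboveGF_eq 0
      rw [fromAboveGF_zero] at this
      rw [zero_add, fromAboveGF_one]
      linear_combination this
    · apply mul_right_cancel₀ (one_sub_fromAboveGF_ne_zero (k + 1))
      have h := cycleGF_eq k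
      rw [cycleGF_eq_fromAboveGF] at h
      linear_combination h - fromAboveGF (k + 3) * ih

theorem blockGF_mul (k : ℕ) : blockGF (k + 5) * (1 - PowerSeries.X) =
    cycleGF (k + 4) * (cycleGF (k + 3) ^ 2 - cycleGF (k + 3) + 1) := by
  have h1 := fromAboveGF_succ_mul (k + 2)
  have h2 := fromAboveGF_succ_mul (k + 3)
  have h3 : cycleToAboveGF (k + 4) - PowerSeries.X = fromAboveGF (k + 3) ^ 2 := by
    apply mul_right_cancel₀ (one_sub_fromAboveGF_ne_zero (k + 2))
    have h := cycleToAboveGF_eq (k + 2)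
    rw [cycleGF_eq_fromAboveGF] at h
    linear_combination h - fromAboveGF (k + 3) * h1
  have h4 := acrossGF_eq (k + 2)
  have h5 := blockGF_eq (k + 3)
  have h6 : cycleGF (k + 4) = fromAboveGF (k + 4) := cycleGF_eq_fromAboveGF (k + 1)
  rw [h6, cycleGF_eq_fromAboveGF]
  apply mul_right_cancel₀ (one_sub_fromAboveGF_ne_zero (k + 3))
  rw [h3] at h4
  linear_combination (1 - PowerSeries.X) * h5 + PowerSeries.X * h4 -
    PowerSeries.X * fromAboveGF (k + 3) * h1 -
    (fromAboveGF (k + 3) ^ 2 - fromAboveGF (k + 3) + 1) * h2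

/-- Here the equation for `cycleToAboveGF 3` involves `cycleGF 2`, where `cycleGF` and `fromAboveGF`
still differ. -/
theorem blockGF_four_mul : blockGF 4 * ((1 - PowerSeries.X) * (1 - 2 * PowerSeries.X)) =
    PowerSeries.X * (PowerSeries.X ^ 3 + PowerSeries.X ^ 2 - 2 * PowerSeries.X + 1) := by
  have h1 := fromAboveGF_succ_mul 1
  have h3 := cycleToAboveGF_eq 1
  have h4 := acrossGF_eq 1
  have h5 := blockGF_eq 2
  simp only [Nat.reduceAdd, fromAboveGF_one, cycleGF_two] at h1 h3 h4 h5
  linear_combination (1 - PowerSeries.X) ^ 2 * h5 +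
    (1 - PowerSeries.X) * (blockGF 4 - PowerSeries.X) * h1 +
    PowerSeries.X * (1 - PowerSeries.X) * h4 + PowerSeries.X ^ 2 * h3

theorem blockGF_three_mul : blockGF 3 * (1 - PowerSeries.X) ^ 2 =
    PowerSeries.X * (1 - PowerSeries.X + PowerSeries.X ^ 2) := by
  have h4 := acrossGF_eq 0
  have h5 := blockGF_eq 1
  simp only [Nat.reduceAdd, fromAboveGF_one, fromAboveGF_zero] at h4 h5
  linear_combination (1 - PowerSeries.X) * h5 + PowerSeries.X * h4

/-! ### The cycle form as a list -/

/-- The cycle form of `π` as a list of natural numbers. -/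
def cycleWord {n : ℕ} (π : Perm (Fin n)) : List ℕ := List.ofFn fun i => (cycleForm π i : ℕ)

theorem length_cycleWord {n : ℕ} (π : Perm (Fin n)) : (cycleWord π).length = n := by
  simp [cycleWord]

variable {n : ℕ} {π ρ : Perm (Fin (n + 1))}

theorem cycleWord_getElem {i : ℕ} (h : i < (cycleWord π).length) :
    (cycleWord π)[i] = ((π ^ i) 0 : Fin (n + 1)) := by
  simp only [cycleWord, List.getElem_ofFn]
  rfl

theorem IsCyclicPerm.isCycleOn (h : IsCyclicPerm π) :
    π.IsCycleOn ((Finset.univ : Finset (Fin (n + 1))) : Set (Fin (n + 1))) := by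
  rw [Finset.coe_univ]
  exact h.2

theorem IsCyclicPerm.exists_pow (h : IsCyclicPerm π) (x : Fin (n + 1)) :
    ∃ i ≤ n, (π ^ i) 0 = x := by
  obtain ⟨i, hi, hx⟩ := h.isCycleOn.exists_pow_eq (Finset.mem_univ 0) (Finset.mem_univ x)
  rw [Finset.card_univ, Fintype.card_fin] at hi
  exact ⟨i, by omega, hx⟩

theorem IsCyclicPerm.pow_succ (h : IsCyclicPerm π) : (π ^ (n + 1)) 0 = 0 := by
  have := h.isCycleOn.pow_card_apply (Finset.mem_univ 0)
  rwa [Finset.card_univ, Fintype.card_fin] at this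

theorem IsCyclicPerm.cycleForm_injective (h : IsCyclicPerm π) :
    Function.Injective (cycleForm π) := by
  rw [Finite.injective_iff_surjective]
  intro x
  obtain ⟨i, hi, hx⟩ := h.exists_pow x
  exact ⟨⟨i, by omega⟩, hx⟩

theorem IsCyclicPerm.eq_of_cycleWord_eq (hπ : IsCyclicPerm π) (hρ : IsCyclicPerm ρ)
    (h : cycleWord π = cycleWord ρ) : π = ρ := by
  have key : ∀ i ≤ n + 1, (π ^ i) 0 = (ρ ^ i) 0 := by
    intro i hi
    rcases hi.lt_or_eq with hi | rfl
    · have h1 := cycleWord_getElem (π := π) (i := i) (by rwa [length_cycleWord])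
      have h2 := cycleWord_getElem (π := ρ) (i := i) (by rwa [length_cycleWord])
      simp only [h] at h1
      exact Fin.ext (h1.symm.trans h2)
    · rw [hπ.pow_succ, hρ.pow_succ]
  ext x
  obtain ⟨i, hi, rfl⟩ := hπ.exists_pow x
  have h1 := key (i + 1) (by omega)
  rw [pow_succ', pow_succ', Perm.mul_apply, Perm.mul_apply] at h1
  rw [h1, key i (by omega)]

theorem IsCyclicPerm.exists_cycleWord_eq (h : IsCyclicPerm π) :
    ∃ T, IsWord 1 n T ∧ cycleWord π = 0 :: T := by
  have hnd : (cycleWord π).Nodup :=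
    List.nodup_ofFn.2 (Fin.val_injective.comp h.cycleForm_injective)
  have hmem : ∀ x, x ∈ cycleWord π ↔ x < n + 1 := by
    intro x
    rw [cycleWord, List.mem_ofFn]
    constructor
    · rintro ⟨i, rfl⟩
      exact Fin.isLt _
    · intro hx
      obtain ⟨i, hi, h⟩ := h.exists_pow ⟨x, hx⟩
      exact ⟨⟨i, by omega⟩, congrArg Fin.val h⟩
  have h0 : cycleWord π = 0 :: (cycleWord π).tail := by
    rw [cycleWord, List.ofFn_succ, List.tail_cons]
    rfl
  refine ⟨_, ?_, h0⟩
  rw [h0, List.nodup_cons] at hnd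
  refine ⟨hnd.2, fun x => ?_⟩
  have h1 := hmem x
  rw [h0, List.mem_cons] at h1
  constructor
  · intro hx
    have hne : x ≠ 0 := fun e => hnd.1 (e ▸ hx)
    have := h1.1 (Or.inr hx)
    omega
  · intro hx
    exact (h1.2 (by omega)).resolve_left (by omega)

/-- The permutation is `List.formPerm` of the word, whose powers at the first letter read off the
word. -/
theorem exists_cycleWord_eq_cons {T : List ℕ} (hT : IsWord 1 n T) :
    ∃ π : Perm (Fin (n + 1)), IsCyclicPerm π ∧ cycleWord π = 0 :: T := by
  have hlen : (0 :: T).length = n + 1 := by rw [List.length_cons, hT.length_eq]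
  have hnd : (0 :: T).Nodup := List.nodup_cons.2 ⟨fun h => by have := (hT.2 0).1 h; omega, hT.1⟩
  have hlt : ∀ x ∈ 0 :: T, x < n + 1 := by
    intro x hx
    rcases List.mem_cons.1 hx with rfl | hx
    · omega
    · have := (hT.2 x).1 hx
      omega
  set g : Fin (n + 1) → Fin (n + 1) := fun i =>
    ⟨(0 :: T)[(i : ℕ)]'(by rw [hlen]; exact i.isLt), hlt _ (List.getElem_mem _)⟩ with hg
  have hinj : Function.Injective g := by
    intro i j hij
    have := (Fin.mk.injEq _ _ _ _).mp hij
    exact Fin.ext ((List.Nodup.getElem_inj_iff hnd).1 this)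
  have hl : (List.ofFn g).Nodup := List.nodup_ofFn.2 hinj
  have huniv : {a | a ∈ List.ofFn g} = Set.univ := by
    ext x
    exact ⟨fun _ => trivial, fun _ => List.mem_ofFn.2 (Finite.injective_iff_surjective.1 hinj x)⟩
  refine ⟨(List.ofFn g).formPerm, ⟨by omega, huniv ▸ List.Nodup.isCycleOn_formPerm hl⟩, ?_⟩
  apply List.ext_getElem
  · rw [length_cycleWord, hlen]
  · intro i h1 h2
    have hi : i < n + 1 := by rwa [hlen] at h2
    rw [cycleWord_getElem]
    have h := List.formPerm_pow_apply_getElem (List.ofFn g) hl i 0 (by simp)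
    simp only [List.getElem_ofFn, List.length_ofFn, zero_add, Nat.mod_eq_of_lt hi] at h
    exact congrArg Fin.val h

/-- The appended 0 supplies the last graph point, since π^(n+1) fixes 0. -/
theorem IsCyclicPerm.mem_path_iff (h : IsCyclicPerm π) {p : ℕ × ℕ} :
    p ∈ path (cycleWord π ++ [0]) ↔ ∃ x : Fin (n + 1), p = ((x : ℕ), (π x : ℕ)) := by
  have hget : ∀ i, i ≤ n + 1 → (cycleWord π ++ [0])[i]? = some (((π ^ i) 0 : Fin (n + 1)) : ℕ) := by
    intro i hi
    rcases hi.lt_or_eq with hi | rfl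
    · rw [List.getElem?_append_left (by rwa [length_cycleWord]),
        List.getElem?_eq_getElem (by rwa [length_cycleWord]), cycleWord_getElem]
    · rw [List.getElem?_append_right (by rw [length_cycleWord]), length_cycleWord, h.pow_succ]
      simp
  rw [CyclicPattern.mem_path_iff]
  constructor
  · rintro ⟨i, h1, h2⟩
    have hi : i + 1 < (cycleWord π ++ [0]).length := (List.getElem?_eq_some_iff.1 h2).1
    rw [List.length_append, length_cycleWord, List.length_singleton] at hi
    rw [hget i (by omega), Option.some.injEq] at h1
    rw [hget (i + 1) (by omega), Option.some.injEq, pow_succ', Perm.mul_apply] at h2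
    exact ⟨(π ^ i) 0, Prod.ext h1.symm h2.symm⟩
  · rintro ⟨x, rfl⟩
    obtain ⟨i, hi, rfl⟩ := h.exists_pow x
    refine ⟨i, hget i (by omega), ?_⟩
    rw [hget (i + 1) (by omega), pow_succ', Perm.mul_apply]

theorem IsCyclicPerm.avoids_decPattern_iff (h : IsCyclicPerm π) {k : ℕ} :
    Avoids (fun i => π i) (decPattern k) ↔ lds (path (cycleWord π ++ [0])) < k := by
  rw [lds_lt_iff, Avoids, not_iff_not]
  constructor
  · rintro ⟨e, he⟩
    refine ⟨Finset.univ.image fun i => ((e i : ℕ), (π (e i) : ℕ)), ?_, ?_, ?_⟩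
    · intro p hp
      obtain ⟨i, _, rfl⟩ := Finset.mem_image.1 hp
      exact h.mem_path_iff.2 ⟨e i, rfl⟩
    · have key : ∀ i j, i < j → NorthWest ((e i : ℕ), (π (e i) : ℕ)) ((e j : ℕ), (π (e j) : ℕ)) := by
        intro i j hij
        refine ⟨e.lt_iff_lt.2 hij, (he j i).2 ?_⟩
        have := i.isLt
        have := j.isLt
        have : (i : ℕ) < j := hij
        simp only [decPattern]
        omega
      rw [Finset.coe_image]
      rintro _ ⟨i, _, rfl⟩ _ ⟨j, _, rfl⟩ hne
      have hij : i ≠ j := fun e => hne (by rw [e])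
      rcases lt_or_gt_of_ne hij with hij | hij
      · exact Or.inl (key _ _ hij)
      · exact Or.inr (key _ _ hij)
    · rw [Finset.card_image_of_injective, Finset.card_univ, Fintype.card_fin]
      intro i j hij
      exact e.injective (Fin.ext (congrArg Prod.fst hij))
  · rintro ⟨U, hU, hc, rfl⟩
    -- Listing the abscissae of the chain in increasing order gives the occurrence of the pattern.
    set V : Finset (Fin (n + 1)) := Finset.univ.filter fun x => ((x : ℕ), (π x : ℕ)) ∈ U with hV
    have hcard : V.card = U.card := by
      refine Finset.card_bij (fun x _ => ((x : ℕ), (π x : ℕ))) ?_ ?_ ?_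
      · intro x hx
        exact (Finset.mem_filter.1 hx).2
      · intro x _ y _ hxy
        exact Fin.ext (congrArg Prod.fst hxy)
      · intro p hp
        obtain ⟨x, rfl⟩ := h.mem_path_iff.1 (hU hp)
        exact ⟨x, Finset.mem_filter.2 ⟨Finset.mem_univ _, hp⟩, rfl⟩
    set e := V.orderEmbOfFin hcard with he
    have hmem : ∀ i, ((e i : ℕ), (π (e i) : ℕ)) ∈ U := fun i =>
      (Finset.mem_filter.1 (V.orderEmbOfFin_mem hcard i)).2
    have key : ∀ i j, i < j → π (e j) < π (e i) := by
      intro i j hij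
      have h1 : e i < e j := e.lt_iff_lt.2 hij
      have h1' : (e i : ℕ) < e j := h1
      rcases hc (hmem i) (hmem j) (fun e => h1'.ne (congrArg Prod.fst e)) with h2 | h2
      · exact h2.2
      · exact absurd h2.1 (not_lt.2 h1'.le)
    refine ⟨e, fun i j => ?_⟩
    have hi := i.isLt
    have hj := j.isLt
    have hdec : decPattern U.card i < decPattern U.card j ↔ j < i := by
      rw [Fin.lt_def]
      simp only [decPattern]
      omega
    rw [hdec]
    constructor
    · intro hlt
      by_contra! hle
      rcases hle.lt_or_eq with h | h
      · exact absurd (key _ _ h) (not_lt.2 hlt.le)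
      · exact hlt.ne (by rw [h])
    · exact key j i

/-! ### Patterns of length three in lists -/

/-- The list `l` has no subsequence in the same relative order as `213`. -/
def ListAvoids213 (l : List ℕ) : Prop := ∀ a b c, [a, b, c].Sublist l → ¬ (b < a ∧ a < c)

theorem triple_sublist_ofFn_iff {m : ℕ} {w : Fin m → ℕ} {a b c : ℕ} :
    [a, b, c].Sublist (List.ofFn w) ↔
      ∃ e : Fin 3 ↪o Fin m, w (e 0) = a ∧ w (e 1) = b ∧ w (e 2) = c := by
  rw [List.sublist_iff_exists_fin_orderEmbedding_get_eq]
  constructor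
  · rintro ⟨f, hf⟩
    refine ⟨f.trans (Fin.castOrderIso (List.length_ofFn)).toOrderEmbedding, ?_, ?_, ?_⟩
    · have h := (hf 0).symm
      rw [List.get_ofFn] at h
      exact h
    · have h := (hf 1).symm
      rw [List.get_ofFn] at h
      exact h
    · have h := (hf 2).symm
      rw [List.get_ofFn] at h
      exact h
  · rintro ⟨e, rfl, rfl, rfl⟩
    refine ⟨e.trans (Fin.castOrderIso (List.length_ofFn).symm).toOrderEmbedding, fun i => ?_⟩
    have : ∀ i : Fin 3, [w (e 0), w (e 1), w (e 2)].get i = w (e i) := by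
      intro i
      fin_cases i <;> rfl
    rw [List.get_ofFn]
    exact this i

theorem avoids_pattern231_iff : Avoids (cycleForm π) pattern231 ↔ ListAvoids231 (cycleWord π) := by
  simp only [ListAvoids231, cycleWord, triple_sublist_ofFn_iff, Avoids, Contains, pattern231]
  constructor
  · rintro h a b c ⟨e, rfl, rfl, rfl⟩ ⟨h1, h2⟩
    refine h ⟨e, ?_⟩
    simp only [Fin.forall_fin_succ, Fin.lt_def]
    simp
    omega
  · rintro h ⟨e, he⟩
    exact h _ _ _ ⟨e, rfl, rfl, rfl⟩ ⟨(he 2 0).2 (by simp), (he 0 1).2 (by simp)⟩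

theorem avoids_pattern213_iff : Avoids (cycleForm π) pattern213 ↔ ListAvoids213 (cycleWord π) := by
  simp only [ListAvoids213, cycleWord, triple_sublist_ofFn_iff, Avoids, Contains, pattern213]
  constructor
  · rintro h a b c ⟨e, rfl, rfl, rfl⟩ ⟨h1, h2⟩
    refine h ⟨e, ?_⟩
    simp only [Fin.forall_fin_succ, Fin.lt_def]
    simp
    omega
  · rintro h ⟨e, he⟩
    exact h _ _ _ ⟨e, rfl, rfl, rfl⟩ ⟨(he 1 0).2 (by simp), (he 0 2).2 (by simp)⟩

/-- A leading 0 could only play the first pattern entry, which must exceed some other letter. -/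
theorem listAvoids231_zero_cons {T : List ℕ} : ListAvoids231 (0 :: T) ↔ ListAvoids231 T := by
  refine ⟨fun h => h.sublist (List.sublist_cons_self _ _), fun h a b c hs hlt => ?_⟩
  rcases List.sublist_cons_iff.1 hs with h' | ⟨r, hr, _⟩
  · exact h a b c h' hlt
  · simp only [List.cons.injEq] at hr
    omega

theorem listAvoids213_zero_cons {T : List ℕ} : ListAvoids213 (0 :: T) ↔ ListAvoids213 T := by
  refine ⟨fun h a b c hs => h a b c (hs.trans (List.sublist_cons_self _ _)),
    fun h a b c hs hlt => ?_⟩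
  rcases List.sublist_cons_iff.1 hs with h' | ⟨r, hr, _⟩
  · exact h a b c h' hlt
  · simp only [List.cons.injEq] at hr
    omega

theorem map_complement_complement {T : List ℕ} {c : ℕ} (h : ∀ x ∈ T, x ≤ c) :
    (T.map fun x => c - x).map (fun x => c - x) = T := by
  rw [List.map_map]
  conv_rhs => rw [← List.map_id T]
  exact List.map_congr_left fun x hx => Nat.sub_sub_self (h x hx)

theorem listAvoids231_map_complement {T : List ℕ} {m : ℕ} (h : ∀ x ∈ T, x ≤ m) :
    ListAvoids231 (T.map fun x => m - x) ↔ ListAvoids213 T := by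
  constructor
  · intro ha a b c hs hlt
    have h1 := h a (hs.subset (by simp))
    have h2 := h b (hs.subset (by simp))
    have h3 := h c (hs.subset (by simp))
    have := ha (m - a) (m - b) (m - c) (hs.map fun x => m - x)
    omega
  · intro ha a b c hs hlt
    obtain ⟨l, hl, he⟩ := List.sublist_map_iff.1 hs
    match l, hl, he with
    | [x, y, z], hl, he =>
      have := ha x y z hl
      simp only [List.map_cons, List.map_nil, List.cons.injEq] at he
      omega
    | [], _, he => simp at he
    | [_], _, he => simp at he
    | [_, _], _, he => simp at he
    | _ :: _ :: _ :: _ :: _, _, he => simp at he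

theorem IsWord.map_complement {T : List ℕ} (h : IsWord 1 n T) :
    IsWord 1 n (T.map fun x => n + 1 - x) := by
  constructor
  · refine h.1.map_on fun x hx y hy hxy => ?_
    have := (h.2 x).1 hx
    have := (h.2 y).1 hy
    omega
  · intro x
    rw [List.mem_map]
    constructor
    · rintro ⟨y, hy, rfl⟩
      have := (h.2 y).1 hy
      omega
    · intro hx
      exact ⟨n + 1 - x, (h.2 _).2 (by omega), by omega⟩

/-! ### Counting -/

/-- Permutations and trees are both determined by the word `0 :: W t`, so both sides count one set
of words. -/
theorem ncard_eq_treeCount {W : BinaryTree Unit → List ℕ} {p : BinaryTree Unit → Prop}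
    {S : Set (Perm (Fin (n + 1)))} (hW : ∀ t, t.numNodes = n → IsWord 1 n (W t))
    (hinj : ∀ t t', t.numNodes = n → t'.numNodes = n → W t = W t' → t = t')
    (hS : ∀ π ∈ S, IsCyclicPerm π ∧ ∃ t, t.numNodes = n ∧ cycleWord π = 0 :: W t)
    (hp : ∀ π t, IsCyclicPerm π → t.numNodes = n → cycleWord π = 0 :: W t → (π ∈ S ↔ p t)) :
    S.ncard = treeCount p n := by
  classical
  have himage : cycleWord '' S =
      ((((BinaryTree.treesOfNumNodesEq n).filter p).image fun t => 0 :: W t : Finset (List ℕ)) :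
        Set (List ℕ)) := by
    ext w
    simp only [Set.mem_image, Finset.coe_image, Finset.coe_filter, Set.mem_ofPred_eq,
      BinaryTree.mem_treesOfNumNodesEq]
    constructor
    · rintro ⟨π, hπ, rfl⟩
      obtain ⟨hc, t, ht, hw⟩ := hS π hπ
      exact ⟨t, ⟨ht, (hp π t hc ht hw).1 hπ⟩, hw.symm⟩
    · rintro ⟨t, ⟨ht, hpt⟩, rfl⟩
      obtain ⟨π, hc, hw⟩ := exists_cycleWord_eq_cons (hW t ht)
      exact ⟨π, (hp π t hc ht hw).2 hpt, hw⟩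
  have hS_inj : Set.InjOn cycleWord S :=
    fun π hπ ρ hρ h => IsCyclicPerm.eq_of_cycleWord_eq (hS π hπ).1 (hS ρ hρ).1 h
  rw [← hS_inj.ncard_image, himage, Set.ncard_coe_finset,
    Finset.card_image_of_injOn, treeCount]
  intro t ht t' ht' h
  simp only [Finset.coe_filter, Set.mem_ofPred_eq, BinaryTree.mem_treesOfNumNodesEq] at ht ht'
  exact hinj t t' ht.1 ht'.1 (List.cons.inj h).2

theorem avoiderCount_zero (k : ℕ) {m : ℕ} (τ : Fin m → ℕ) : avoiderCount 0 k τ = 0 := by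
  have : cyclicAvoiders 0 (decPattern k) τ = ∅ :=
    Set.eq_empty_iff_forall_notMem.2 fun π h => absurd h.1.1 (lt_irrefl 0)
  rw [avoiderCount, this, Set.ncard_empty]

theorem avoiderCount_pattern231 (n k : ℕ) :
    avoiderCount (n + 1) k pattern231 = treeCount (fun t => blockStat t < k) n := by
  refine ncard_eq_treeCount (W := fun t => blockWord t 1) ?_ ?_ ?_ ?_
  · rintro t rfl
    exact isWord_blockWord t 1
  · exact fun t t' _ _ h => blockWord_injective 1 t t' h
  · rintro π ⟨hc, _, ha⟩
    obtain ⟨T, hT, hw⟩ := hc.exists_cycleWord_eq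
    rw [avoids_pattern231_iff, hw, listAvoids231_zero_cons] at ha
    obtain ⟨t, ht, rfl⟩ := exists_blockWord n 1 T hT ha
    exact ⟨hc, t, ht, hw⟩
  · intro π t hc ht hw
    have h : π ∈ cyclicAvoiders (n + 1) (decPattern k) pattern231 ↔
      IsCyclicPerm π ∧ Avoids (fun i => π i) (decPattern k) ∧ Avoids (cycleForm π) pattern231 :=
      Iff.rfl
    rw [h, hc.avoids_decPattern_iff, avoids_pattern231_iff, hw, listAvoids231_zero_cons,
      List.cons_append, lds_path_blockWord t 1 0 0 one_pos one_pos]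
    have := listAvoids231_blockWord t 1
    tauto

theorem avoiderCount_pattern213 (n k : ℕ) :
    avoiderCount (n + 1) k pattern213 = treeCount (fun t => (stats t).cycle < k) n := by
  have hle : ∀ t : BinaryTree Unit, t.numNodes = n → ∀ x ∈ peakWord t 1, x ≤ n + 1 := by
    intro t ht x hx
    rw [mem_peakWord] at hx
    omega
  refine ncard_eq_treeCount (W := fun t => (peakWord t 1).map fun x => n + 1 - x) ?_ ?_ ?_ ?_
  · rintro t rfl
    exact (isWord_peakWord t 1).map_complement
  · intro t t' ht ht' h
    have h1 := congrArg (List.map fun x => n + 1 - x) h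
    simp only [map_complement_complement (hle _ ht), map_complement_complement (hle _ ht')] at h1
    exact peakWord_injective 1 t t' h1
  · rintro π ⟨hc, _, ha⟩
    obtain ⟨T, hT, hw⟩ := hc.exists_cycleWord_eq
    have hTle : ∀ x ∈ T, x ≤ n + 1 := by
      intro x hx
      have := (hT.2 x).1 hx
      omega
    rw [avoids_pattern213_iff, hw, listAvoids213_zero_cons,
      ← listAvoids231_map_complement hTle] at ha
    obtain ⟨t, ht, he⟩ := exists_peakWord n 1 _ hT.map_complement ha
    refine ⟨hc, t, ht, ?_⟩
    rw [hw, he, map_complement_complement hTle]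
  · intro π t hc ht hw
    have h : π ∈ cyclicAvoiders (n + 1) (decPattern k) pattern213 ↔
      IsCyclicPerm π ∧ Avoids (fun i => π i) (decPattern k) ∧ Avoids (cycleForm π) pattern213 :=
      Iff.rfl
    have hpath : lds (path (0 :: (peakWord t 1).map (fun x => n + 1 - x) ++ [0])) =
        (stats t).cycle := by
      -- Complementing sends the outer 0 to n + 1, so the closed path starts and ends above the
      -- word, as `cycle` requires.
      have e : 0 :: (peakWord t 1).map (fun x => n + 1 - x) ++ [0] =
          ((n + 1) :: (peakWord t 1 ++ [n + 1])).map fun x => n + 1 - x := by simp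
      rw [e, path_map, lds_image_complement]
      · exact (lds_path_peakWord t 1 (n + 1) (n + 1) (by omega) (by omega)).2.1
      · intro p hp
        have hall : ∀ x ∈ (n + 1) :: (peakWord t 1 ++ [n + 1]), x ≤ n + 1 := by
          intro x hx
          simp only [List.mem_cons, List.mem_append, List.not_mem_nil, or_false] at hx
          rcases hx with rfl | hx | rfl
          · exact le_rfl
          · exact hle t ht x hx
          · exact le_rfl
        exact ⟨hall _ (mem_path hp).1, hall _ (mem_path hp).2⟩
    have hav : ListAvoids213 ((peakWord t 1).map fun x => n + 1 - x) := by
      rw [← listAvoids231_map_complement (m := n + 1), map_complement_complement (hle t ht)]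
      · exact listAvoids231_peakWord t 1
      · intro x hx
        obtain ⟨y, _, rfl⟩ := List.mem_map.1 hx
        exact Nat.sub_le _ _
    rw [h, hc.avoids_decPattern_iff, avoids_pattern213_iff, hw, listAvoids213_zero_cons, hpath]
    tauto

theorem genFun_eq_treeGF {k m : ℕ} {τ : Fin m → ℕ} {p : BinaryTree Unit → Prop}
    (h : ∀ n, avoiderCount (n + 1) k τ = treeCount p n) : genFun k τ = treeGF p := by
  ext n
  rw [genFun, treeGF, PowerSeries.coeff_mk]
  rcases n with _ | n
  · simp [avoiderCount_zero]
  · rw [PowerSeries.coeff_succ_X_mul, PowerSeries.coeff_mk, h]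

theorem genFun_pattern231 (k : ℕ) : genFun k pattern231 = blockGF k :=
  genFun_eq_treeGF fun n => avoiderCount_pattern231 n k

theorem genFun_pattern213 (k : ℕ) : genFun k pattern213 = cycleGF k :=
  genFun_eq_treeGF fun n => avoiderCount_pattern213 n k

end CyclicPattern

theorem theorem2p11 :
    (∀ k : ℕ, 5 ≤ k →
      CyclicPattern.genFun k CyclicPattern.pattern231 =
        CyclicPattern.genFun (k - 1) CyclicPattern.pattern213 *
          (CyclicPattern.genFun (k - 2) CyclicPattern.pattern213 ^ 2 -
            CyclicPattern.genFun (k - 2) CyclicPattern.pattern213 + 1) *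
          (1 - PowerSeries.X)⁻¹) ∧
    CyclicPattern.genFun 4 CyclicPattern.pattern231 =
      PowerSeries.X *
        (PowerSeries.X ^ 3 + PowerSeries.X ^ 2 - 2 * PowerSeries.X + 1) *
        ((1 - PowerSeries.X) * (1 - 2 * PowerSeries.X))⁻¹ ∧
    CyclicPattern.genFun 3 CyclicPattern.pattern231 =
      PowerSeries.X * (1 - PowerSeries.X + PowerSeries.X ^ 2) *
        ((1 - PowerSeries.X) ^ 2)⁻¹ ∧
    CyclicPattern.genFun 2 CyclicPattern.pattern231 = PowerSeries.X ∧
    CyclicPattern.genFun 1 CyclicPattern.pattern231 = 0 := by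
  simp only [CyclicPattern.genFun_pattern231, CyclicPattern.genFun_pattern213]
  refine ⟨fun k hk => ?_, ?_, ?_, CyclicPattern.blockGF_two, CyclicPattern.blockGF_one⟩
  · obtain ⟨k, rfl⟩ := Nat.exists_eq_add_of_le' hk
    -- The denominator has nonzero constant term, so the inverse is genuine and not the default 0.
    rw [PowerSeries.eq_mul_inv_iff_mul_eq (by simp)]
    exact CyclicPattern.blockGF_mul k
  · rw [PowerSeries.eq_mul_inv_iff_mul_eq (by simp)]
    exact CyclicPattern.blockGF_four_mul
  · rw [PowerSeries.eq_mul_inv_iff_mul_eq (by simp)]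
    exact CyclicPattern.blockGF_three_mul
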